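/- Manifolds are smooth, finite-dimensional (each of some fixed dimension), Hausdorff, second countable and without boundary. A Lie groupoid $G\rightrightarrows M$ consists of manifolds $M$ (objects) and $G$ (arrows), submersions $s,t:G\to M$ (source and target), and a smooth associative multiplication $(g_2,g_1)\mapsto g_2g_1$, defined on the submanifold of pairs with $s(g_2)=t(g_1)$, with smooth units and inverses. Its anchor is $\rho=(t,s):G\to M\times M$. A map of Lie groupoids is a pair of smooth maps on objects and on arrows that preserves source, target and multiplication. A pullback $P=X\times_B Y$ of smooth maps $f:X\to B$, $g:Y\to B$ in the category of smooth manifolds is good if it is also a pullback of the underlying topological spaces and, for all $(x,y)\in P$, the tangent space $T_{(x,y)}P$ is the pullback of $d_xf:T_xX\to T_bB$ and $d_yg:T_yY\to T_bB$, where $b=f(x)=g(y)$. A map $\phi:(G\rightrightarrows M)\to(G'\rightrightarrows M')$ is fully faithful if $\phi:G\to G'$, $\rho:G\to M\times M$, $\rho':G'\to M'\times M'$, $\phi\times\phi:M\times M\to M'\times M'$ form a good pullback square. It is essentially surjective if $G'\times_{M'}M=\{(g',x): s(g')=\phi(x)\}\to M'$, $(g',x)\mapsto t(g')$, is a surjective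 submersion. It is surjective if $\phi:M\to M'$ is a surjective submersion. A weak equivalence is a fully faithful and essentially surjective map; a surjective equivalence is a fully faithful and surjective map. Let $\phi_1:(G_1\rightrightarrows M_1)\to(G\rightrightarrows M)$ and $\phi_2:(G_2\rightrightarrows M_2)\to(G\rightrightarrows M)$ be maps of Lie groupoids. Their homotopy pullback $G_1\tilde\times_G G_2$ is the groupoid whose objects are the triples $(x_1,g,x_2)\in M_1\times G\times M_2$ with $t(g)=\phi_1(x_1)$ and $s(g)=\phi_2(x_2)$, and whose arrows are the triples $(k_1,k_2,k_3)\in G_1\times G\times G_2$ with $s(\phi_1(k_1))=t(k_2)$ and $s(k_2)=t(\phi_2(k_3))$. The source of $(k_1,k_2,k_3)$ is $(s(k_1),k_2\phi_2(k_3),s(k_3))$, its target is $(t(k_1),\phi_1(k_1)k_2,t(k_3))$, and composition is $$(l_1,l_2,l_3)(k_1,k_2,k_3)=(l_1k_1,\;k_2\phi_2(l_3)^{-1},\;l_3k_3).$$ It is said to exist (as a Lie groupoid) if its sets of objects and of arrows carry smooth structures making them the good pullbacks $M_1\times_M G\times_M M_2$ and $G_1\times_M G\times_M G_2$, and it is a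 Lie groupoid with these structures. The base-change of $\phi_1$ is then the map $\tilde\phi_1:G_1\tilde\times_G G_2\to G_2$ given by $(x_1,g,x_2)\mapsto x_2$ and $(k_1,k_2,k_3)\mapsto k_3$. **Proposition.** If $\phi_1$ is a weak equivalence, then the homotopy pullback $G_1\tilde\times_G G_2$ exists as a Lie groupoid, and the base-change $\tilde\phi_1$ of $\phi_1$ is a surjective equivalence. -/

import Mathlib

open Set Topology
open scoped Manifold ContDiff

universe u

/-! ### Good pullbacks of manifolds -/

section GoodPullback

variable
  {EP : Type*} [NormedAddCommGroup EP] [NormedSpace ℝ EP] {HP : Type*} [TopologicalSpace HP]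
  {EX : Type*} [NormedAddCommGroup EX] [NormedSpace ℝ EX] {HX : Type*} [TopologicalSpace HX]
  {EY : Type*} [NormedAddCommGroup EY] [NormedSpace ℝ EY] {HY : Type*} [TopologicalSpace HY]
  {EB : Type*} [NormedAddCommGroup EB] [NormedSpace ℝ EB] {HB : Type*} [TopologicalSpace HB]
  (IP : ModelWithCorners ℝ EP HP) (IX : ModelWithCorners ℝ EX HX)
  (IY : ModelWithCorners ℝ EY HY) (IB : ModelWithCorners ℝ EB HB)
  {P X Y B : Type u}
  [TopologicalSpace P] [ChartedSpace HP P] [TopologicalSpace X] [ChartedSpace HX X]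
  [TopologicalSpace Y] [ChartedSpace HY Y] [TopologicalSpace B] [ChartedSpace HB B]

/-- The square with legs `p : P → X`, `q : P → Y` over `f : X → B`, `g : Y → B` is a *good pullback*
of smooth manifolds: it is a pullback in the category of smooth manifolds (`lift`), it is a pullback
of the underlying topological spaces (`embedding`, `range_eq`), and it induces pullbacks between
the tangent spaces (`tangent_comm`, `tangent`). -/
structure IsGoodPullback (p : P → X) (q : P → Y) (f : X → B) (g : Y → B) : Prop where
  smooth_left : ContMDiff IP IX ∞ p
  smooth_right : ContMDiff IP IY ∞ q
  comm : ∀ z, f (p z) = g (q z)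
  lift : ∀ (n : ℕ) (Z : Type u) [TopologicalSpace Z] [T2Space Z] [SecondCountableTopology Z]
    [ChartedSpace (EuclideanSpace ℝ (Fin n)) Z] [IsManifold (𝓡 n) ∞ Z] (a : Z → X) (b : Z → Y),
    ContMDiff (𝓡 n) IX ∞ a → ContMDiff (𝓡 n) IY ∞ b → (∀ z, f (a z) = g (b z)) →
    ∃! c : Z → P, ContMDiff (𝓡 n) IP ∞ c ∧ (∀ z, p (c z) = a z) ∧ (∀ z, q (c z) = b z)
  embedding : IsEmbedding (fun z => (p z, q z))
  range_eq : range (fun z => (p z, q z)) = {w : X × Y | f w.1 = g w.2}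
  tangent_comm : ∀ (z : P) (v : TangentSpace IP z),
    (mfderiv IX IB f (p z) (mfderiv IP IX p z v) : EB)
      = (mfderiv IY IB g (q z) (mfderiv IP IY q z v) : EB)
  tangent : ∀ (z : P) (v : TangentSpace IX (p z)) (w : TangentSpace IY (q z)),
    (mfderiv IX IB f (p z) v : EB) = (mfderiv IY IB g (q z) w : EB) →
    ∃! t : TangentSpace IP z, mfderiv IP IX p z t = v ∧ mfderiv IP IY q z t = w

end GoodPullback

/-! ### Groupoids -/

/-- The algebraic structure of a groupoid with set of objects `M` and set of arrows `G`.
Arrows are composed from right to left: `mul g h` is `g` after `h`. -/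
structure GroupoidStr (M G : Type u) where
  src : G → M
  tgt : G → M
  mul : (g h : G) → src g = tgt h → G
  unit : M → G
  inv : G → G
  src_mul : ∀ g h w, src (mul g h w) = src h
  tgt_mul : ∀ g h w, tgt (mul g h w) = tgt g
  src_unit : ∀ x, src (unit x) = x
  tgt_unit : ∀ x, tgt (unit x) = x
  src_inv : ∀ g, src (inv g) = tgt g
  tgt_inv : ∀ g, tgt (inv g) = src g
  mul_assoc : ∀ g h k (w : src g = tgt h) (w' : src h = tgt k),
    mul (mul g h w) k ((src_mul g h w).trans w') = mul g (mul h k w') (w.trans (tgt_mul h k w').symm)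
  mul_unit : ∀ g, mul g (unit (src g)) (tgt_unit _).symm = g
  unit_mul : ∀ g, mul (unit (tgt g)) g (src_unit _) = g
  mul_inv : ∀ g, mul g (inv g) (tgt_inv g).symm = unit (tgt g)
  inv_mul : ∀ g, mul (inv g) g (src_inv g) = unit (src g)

namespace GroupoidStr

variable {M G : Type u} (S : GroupoidStr M G)

/-- The anchor `ρ = (t, s)`. -/
def anchor (g : G) : M × M := (S.tgt g, S.src g)

theorem mul_congr {g g' h h' : G} (hg : g = g') (hh : h = h') (w : S.src g = S.tgt h) :
    S.mul g h w = S.mul g' h' (by rw [← hg, ← hh]; exact w) := by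
  subst hg hh; rfl

theorem mul_unit' {g : G} {x : M} (w : S.src g = S.tgt (S.unit x)) :
    S.mul g (S.unit x) w = g := by
  obtain rfl : x = S.src g := by rw [w, S.tgt_unit]
  exact S.mul_unit g

theorem unit_mul' {g : G} {x : M} (w : S.src (S.unit x) = S.tgt g) :
    S.mul (S.unit x) g w = g := by
  obtain rfl : x = S.tgt g := by rw [← w, S.src_unit]
  exact S.unit_mul g

/-- An idempotent arrow is a unit. -/
theorem eq_unit_of_mul_self {g : G} (w : S.src g = S.tgt g) (h : S.mul g g w = g) :
    g = S.unit (S.src g) := by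
  have h1 := S.mul_assoc (S.inv g) g g (S.src_inv g) w
  rw [S.mul_congr (S.inv_mul g) rfl, S.unit_mul' (by rw [S.src_unit]; exact w),
    S.mul_congr rfl h, S.inv_mul] at h1
  exact h1

theorem mul_inv_cancel_right (g h : G) (w : S.src g = S.tgt h) :
    S.mul (S.mul g h w) (S.inv h) (by rw [S.src_mul, S.tgt_inv]) = g := by
  rw [S.mul_assoc g h (S.inv h) w (S.tgt_inv h).symm, S.mul_congr rfl (S.mul_inv h), S.mul_unit']

theorem inv_mul_cancel_right (g h : G) (w : S.src g = S.src h) :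
    S.mul (S.mul g (S.inv h) (by rw [S.tgt_inv, w])) h (by rw [S.src_mul, S.src_inv]) = g := by
  rw [S.mul_assoc g (S.inv h) h (by rw [S.tgt_inv, w]) (S.src_inv h), S.mul_congr rfl (S.inv_mul h),
    S.mul_unit']

theorem inv_mul_cancel_left (g h : G) (w : S.src g = S.tgt h) :
    S.mul (S.inv g) (S.mul g h w) (by rw [S.src_inv, S.tgt_mul]) = h := by
  rw [← S.mul_assoc (S.inv g) g h (S.src_inv g) w, S.mul_congr (S.inv_mul g) rfl, S.unit_mul']

theorem eq_inv_of_mul {g h : G} (w : S.src g = S.tgt h) (e : S.mul g h w = S.unit (S.tgt g)) :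
    h = S.inv g := by
  rw [← S.inv_mul_cancel_left g h w, S.mul_congr rfl e, S.mul_unit']

theorem inv_inv (g : G) : S.inv (S.inv g) = g :=
  (S.eq_inv_of_mul (S.src_inv g) (by rw [S.inv_mul, S.tgt_inv])).symm

theorem inv_unit (x : M) : S.inv (S.unit x) = S.unit x :=
  (S.eq_inv_of_mul (by rw [S.src_unit, S.tgt_unit]) (by rw [S.mul_unit', S.tgt_unit])).symm

theorem inv_mul_rev (g h : G) (w : S.src g = S.tgt h) :
    S.inv (S.mul g h w) = S.mul (S.inv h) (S.inv g) (by rw [S.src_inv, S.tgt_inv, w]) := by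
  refine (S.eq_inv_of_mul (by rw [S.src_mul, S.tgt_mul, S.tgt_inv]) ?_).symm
  rw [← S.mul_assoc (S.mul g h w) (S.inv h) (S.inv g) (by rw [S.src_mul, S.tgt_inv])
    (by rw [S.src_inv, S.tgt_inv, w]), S.mul_congr (S.mul_inv_cancel_right g h w) rfl, S.mul_inv,
    S.tgt_mul]

variable {dM dG : ℕ}
  [TopologicalSpace M] [ChartedSpace (EuclideanSpace ℝ (Fin dM)) M]
  [TopologicalSpace G] [ChartedSpace (EuclideanSpace ℝ (Fin dG)) G]

variable (dM dG) in
/-- The structural maps are smooth, and source and target are submersions. Smoothness of the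
multiplication refers to the embedded submanifold of composable pairs in `G × G`. -/
structure IsLie : Prop where
  src_submersion : Manifold.IsSubmersion (𝓡 dG) (𝓡 dM) ∞ S.src
  tgt_submersion : Manifold.IsSubmersion (𝓡 dG) (𝓡 dM) ∞ S.tgt
  smooth_mul : ∃ F : G × G → G,
    ContMDiffOn ((𝓡 dG).prod (𝓡 dG)) (𝓡 dG) ∞ F {p | S.src p.1 = S.tgt p.2} ∧
      ∀ g h w, F (g, h) = S.mul g h w
  smooth_unit : ContMDiff (𝓡 dM) (𝓡 dG) ∞ S.unit
  smooth_inv : ContMDiff (𝓡 dG) (𝓡 dG) ∞ S.inv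

end GroupoidStr

/-- A Lie groupoid `Ar ⇉ Ob`: objects and arrows are smooth manifolds without boundary
(Hausdorff, second countable, of some finite dimension). -/
structure LieGroupoid where
  Ob : Type u
  Ar : Type u
  dimOb : ℕ
  dimAr : ℕ
  [topOb : TopologicalSpace Ob]
  [t2Ob : T2Space Ob]
  [scOb : SecondCountableTopology Ob]
  [chartedOb : ChartedSpace (EuclideanSpace ℝ (Fin dimOb)) Ob]
  [mfdOb : IsManifold (𝓡 dimOb) ∞ Ob]
  [topAr : TopologicalSpace Ar]
  [t2Ar : T2Space Ar]
  [scAr : SecondCountableTopology Ar]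
  [chartedAr : ChartedSpace (EuclideanSpace ℝ (Fin dimAr)) Ar]
  [mfdAr : IsManifold (𝓡 dimAr) ∞ Ar]
  str : GroupoidStr Ob Ar
  isLie : str.IsLie dimOb dimAr

namespace LieGroupoid

attribute [instance] topOb t2Ob scOb chartedOb mfdOb topAr t2Ar scAr chartedAr mfdAr

/-- A map of Lie groupoids. -/
structure Hom (A B : LieGroupoid.{u}) where
  ob : A.Ob → B.Ob
  ar : A.Ar → B.Ar
  smooth_ob : ContMDiff (𝓡 A.dimOb) (𝓡 B.dimOb) ∞ ob
  smooth_ar : ContMDiff (𝓡 A.dimAr) (𝓡 B.dimAr) ∞ ar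
  src_ar : ∀ g, B.str.src (ar g) = ob (A.str.src g)
  tgt_ar : ∀ g, B.str.tgt (ar g) = ob (A.str.tgt g)
  map_mul : ∀ g h (w : A.str.src g = A.str.tgt h),
    ar (A.str.mul g h w) = B.str.mul (ar g) (ar h) (by rw [src_ar, tgt_ar, w])

namespace Hom

variable {A B : LieGroupoid.{u}} (φ : Hom A B)

theorem map_unit (x : A.Ob) : φ.ar (A.str.unit x) = B.str.unit (φ.ob x) := by
  have w : A.str.src (A.str.unit x) = A.str.tgt (A.str.unit x) := by
    rw [A.str.src_unit, A.str.tgt_unit]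
  have h := B.str.eq_unit_of_mul_self (g := φ.ar (A.str.unit x))
    (by rw [φ.src_ar, φ.tgt_ar, w]) (by rw [← φ.map_mul _ _ w, A.str.mul_unit'])
  rwa [φ.src_ar, A.str.src_unit] at h

theorem map_inv (g : A.Ar) : φ.ar (A.str.inv g) = B.str.inv (φ.ar g) := by
  refine B.str.eq_inv_of_mul (by rw [φ.src_ar, φ.tgt_ar, A.str.tgt_inv]) ?_
  rw [← φ.map_mul _ _ (A.str.tgt_inv g).symm, A.str.mul_inv, φ.map_unit, φ.tgt_ar]

/-- `φ` is fully faithful: the square formed by `φ` and the anchors is a good pullback. -/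
def IsFullyFaithful : Prop :=
  IsGoodPullback (𝓡 A.dimAr) (𝓡 B.dimAr) ((𝓡 A.dimOb).prod (𝓡 A.dimOb))
    ((𝓡 B.dimOb).prod (𝓡 B.dimOb)) φ.ar A.str.anchor B.str.anchor (Prod.map φ.ob φ.ob)

/-- The fibre product of `s : B.Ar → B.Ob` and `φ : A.Ob → B.Ob`. -/
abbrev ArrowsFrom : Type u := {p : B.Ar × A.Ob // B.str.src p.1 = φ.ob p.2}

/-- `φ` is essentially surjective: with its smooth structure as a good pullback of `s` and `φ`
on objects, the map `(y ← φ(x), x) ↦ y` is a surjective submersion. -/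
def IsEssentiallySurjective : Prop :=
  ∃ (n : ℕ) (_ : ChartedSpace (EuclideanSpace ℝ (Fin n)) φ.ArrowsFrom)
    (_ : IsManifold (𝓡 n) ∞ φ.ArrowsFrom),
    IsGoodPullback (𝓡 n) (𝓡 B.dimAr) (𝓡 A.dimOb) (𝓡 B.dimOb)
      (fun p : φ.ArrowsFrom => p.1.1) (fun p : φ.ArrowsFrom => p.1.2) B.str.src φ.ob ∧
    Function.Surjective (fun p : φ.ArrowsFrom => B.str.tgt p.1.1) ∧
    Manifold.IsSubmersion (𝓡 n) (𝓡 B.dimOb) ∞ (fun p : φ.ArrowsFrom => B.str.tgt p.1.1)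

/-- `φ` is a weak equivalence. -/
def IsWeakEquivalence : Prop := φ.IsFullyFaithful ∧ φ.IsEssentiallySurjective

/-- `φ` is surjective: it is a surjective submersion on objects. -/
def IsSurjective : Prop :=
  Function.Surjective φ.ob ∧ Manifold.IsSubmersion (𝓡 A.dimOb) (𝓡 B.dimOb) ∞ φ.ob

/-- `φ` is a surjective equivalence. -/
def IsSurjectiveEquivalence : Prop := φ.IsSurjective ∧ φ.IsFullyFaithful

end Hom

/-! ### Homotopy pullbacks -/

section HomotopyPullback

variable {G G₁ G₂ : LieGroupoid.{u}} (φ₁ : Hom G₁ G) (φ₂ : Hom G₂ G)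

/-- Objects of the homotopy pullback: triples `(x₁, φ₁(x₁) ←g— φ₂(x₂), x₂)`. -/
abbrev HPullOb : Type u :=
  {p : G₁.Ob × G.Ar × G₂.Ob // G.str.tgt p.2.1 = φ₁.ob p.1 ∧ G.str.src p.2.1 = φ₂.ob p.2.2}

/-- Arrows of the homotopy pullback: triples `(k₁, k₂, k₃)` with `k₁ : x₁ → y₁`,
`k₂ : φ₂(y₂) → φ₁(x₁)` and `k₃ : x₂ → y₂`. -/
abbrev HPullAr : Type u :=
  {k : G₁.Ar × G.Ar × G₂.Ar //
    G.str.src (φ₁.ar k.1) = G.str.tgt k.2.1 ∧ G.str.src k.2.1 = G.str.tgt (φ₂.ar k.2.2)}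

variable {φ₁ φ₂}

/-- The source of `(k₁, k₂, k₃)` is `(s(k₁), k₂ φ₂(k₃), s(k₃))`. -/
def hpullSrc (k : HPullAr φ₁ φ₂) : HPullOb φ₁ φ₂ :=
  ⟨(G₁.str.src k.1.1, G.str.mul k.1.2.1 (φ₂.ar k.1.2.2) k.2.2, G₂.str.src k.1.2.2),
    (G.str.tgt_mul _ _ _).trans (k.2.1.symm.trans (φ₁.src_ar _)),
    (G.str.src_mul _ _ _).trans (φ₂.src_ar _)⟩

/-- The target of `(k₁, k₂, k₃)` is `(t(k₁), φ₁(k₁) k₂, t(k₃))`. -/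
def hpullTgt (k : HPullAr φ₁ φ₂) : HPullOb φ₁ φ₂ :=
  ⟨(G₁.str.tgt k.1.1, G.str.mul (φ₁.ar k.1.1) k.1.2.1 k.2.1, G₂.str.tgt k.1.2.2),
    (G.str.tgt_mul _ _ _).trans (φ₁.tgt_ar _),
    (G.str.src_mul _ _ _).trans (k.2.2.trans (φ₂.tgt_ar _))⟩

theorem hpullOb_ext {p q : HPullOb φ₁ φ₂} (h₁ : p.1.1 = q.1.1) (h₂ : p.1.2.1 = q.1.2.1)
    (h₃ : p.1.2.2 = q.1.2.2) : p = q :=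
  Subtype.ext (Prod.ext h₁ (Prod.ext h₂ h₃))

theorem hpullAr_ext {k l : HPullAr φ₁ φ₂} (h₁ : k.1.1 = l.1.1) (h₂ : k.1.2.1 = l.1.2.1)
    (h₃ : k.1.2.2 = l.1.2.2) : k = l :=
  Subtype.ext (Prod.ext h₁ (Prod.ext h₂ h₃))

theorem hpull_comp₁ {l k : HPullAr φ₁ φ₂} (w : hpullSrc l = hpullTgt k) :
    G₁.str.src l.1.1 = G₁.str.tgt k.1.1 :=
  congrArg (fun p : HPullOb φ₁ φ₂ => p.1.1) w

theorem hpull_comp₂ {l k : HPullAr φ₁ φ₂} (w : hpullSrc l = hpullTgt k) :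
    G.str.mul l.1.2.1 (φ₂.ar l.1.2.2) l.2.2 = G.str.mul (φ₁.ar k.1.1) k.1.2.1 k.2.1 :=
  congrArg (fun p : HPullOb φ₁ φ₂ => p.1.2.1) w

theorem hpull_comp₃ {l k : HPullAr φ₁ φ₂} (w : hpullSrc l = hpullTgt k) :
    G₂.str.src l.1.2.2 = G₂.str.tgt k.1.2.2 :=
  congrArg (fun p : HPullOb φ₁ φ₂ => p.1.2.2) w

theorem hpull_mid {l k : HPullAr φ₁ φ₂} (w : hpullSrc l = hpullTgt k) :
    G.str.src k.1.2.1 = G.str.tgt (G.str.inv (φ₂.ar l.1.2.2)) := by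
  rw [G.str.tgt_inv, k.2.2, φ₂.tgt_ar, φ₂.src_ar, hpull_comp₃ w]

/-- `(l₁, l₂, l₃) (k₁, k₂, k₃) = (l₁ k₁, k₂ φ₂(l₃)⁻¹, l₃ k₃)`. -/
def hpullMul (l k : HPullAr φ₁ φ₂) (w : hpullSrc l = hpullTgt k) : HPullAr φ₁ φ₂ :=
  ⟨(G₁.str.mul l.1.1 k.1.1 (hpull_comp₁ w),
    G.str.mul k.1.2.1 (G.str.inv (φ₂.ar l.1.2.2)) (hpull_mid w),
    G₂.str.mul l.1.2.2 k.1.2.2 (hpull_comp₃ w)), by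
    constructor
    · dsimp only
      rw [φ₁.src_ar, G₁.str.src_mul, ← φ₁.src_ar, G.str.tgt_mul]
      exact k.2.1
    · dsimp only
      rw [G.str.src_mul, G.str.src_inv, φ₂.map_mul, G.str.tgt_mul]⟩

/-- The unit at `(x₁, g, x₂)` is `(1, g, 1)`. -/
def hpullUnit (p : HPullOb φ₁ φ₂) : HPullAr φ₁ φ₂ :=
  ⟨(G₁.str.unit p.1.1, p.1.2.1, G₂.str.unit p.1.2.2), by
    constructor
    · dsimp only
      rw [φ₁.map_unit, G.str.src_unit]
      exact p.2.1.symm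
    · dsimp only
      rw [φ₂.map_unit, G.str.tgt_unit]
      exact p.2.2⟩

theorem hpull_inv_aux (k : HPullAr φ₁ φ₂) :
    G.str.src (φ₁.ar k.1.1) = G.str.tgt (G.str.mul k.1.2.1 (φ₂.ar k.1.2.2) k.2.2) :=
  k.2.1.trans (G.str.tgt_mul _ _ _).symm

/-- The inverse of `(k₁, k₂, k₃)` is `(k₁⁻¹, φ₁(k₁) k₂ φ₂(k₃), k₃⁻¹)`. -/
def hpullInv (k : HPullAr φ₁ φ₂) : HPullAr φ₁ φ₂ :=
  ⟨(G₁.str.inv k.1.1,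
    G.str.mul (φ₁.ar k.1.1) (G.str.mul k.1.2.1 (φ₂.ar k.1.2.2) k.2.2) (hpull_inv_aux k),
    G₂.str.inv k.1.2.2), by
    constructor
    · dsimp only
      rw [φ₁.map_inv, G.str.src_inv, G.str.tgt_mul]
    · dsimp only
      rw [φ₂.map_inv, G.str.tgt_inv, G.str.src_mul, G.str.src_mul]⟩

theorem hpull_src_mul (l k : HPullAr φ₁ φ₂) (w : hpullSrc l = hpullTgt k) :
    hpullSrc (hpullMul l k w) = hpullSrc k := by
  refine hpullOb_ext (G₁.str.src_mul _ _ _) ?_ (G₂.str.src_mul _ _ _)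
  dsimp only [hpullSrc, hpullMul]
  have h3 : G.str.src (φ₂.ar l.1.2.2) = G.str.tgt (φ₂.ar k.1.2.2) := by
    rw [φ₂.src_ar, φ₂.tgt_ar, hpull_comp₃ w]
  have h4 : G.str.src k.1.2.1 = G.str.src (φ₂.ar l.1.2.2) := k.2.2.trans h3.symm
  refine (G.str.mul_congr rfl (φ₂.map_mul _ _ (hpull_comp₃ w)) _).trans ?_
  rw [← G.str.mul_assoc _ _ _ (by rw [G.str.src_mul, G.str.src_inv]) h3,
    G.str.mul_congr (G.str.inv_mul_cancel_right _ _ h4) rfl]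

theorem hpull_tgt_mul (l k : HPullAr φ₁ φ₂) (w : hpullSrc l = hpullTgt k) :
    hpullTgt (hpullMul l k w) = hpullTgt l := by
  refine hpullOb_ext (G₁.str.tgt_mul _ _ _) ?_ (G₂.str.tgt_mul _ _ _)
  dsimp only [hpullTgt, hpullMul]
  have h1 : G.str.src (φ₁.ar l.1.1) = G.str.tgt (φ₁.ar k.1.1) := by
    rw [φ₁.src_ar, φ₁.tgt_ar, hpull_comp₁ w]
  have h5 : G.str.src (G.str.mul (φ₁.ar k.1.1) k.1.2.1 k.2.1)
      = G.str.tgt (G.str.inv (φ₂.ar l.1.2.2)) := (G.str.src_mul _ _ _).trans (hpull_mid w)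
  refine (G.str.mul_congr (φ₁.map_mul _ _ (hpull_comp₁ w)) rfl _).trans ?_
  rw [G.str.mul_assoc _ _ _ h1 (k.2.1.trans (G.str.tgt_mul _ _ _).symm),
    G.str.mul_congr rfl (G.str.mul_assoc _ _ _ k.2.1 (hpull_mid w)).symm,
    G.str.mul_congr rfl (G.str.mul_congr (hpull_comp₂ w).symm rfl h5),
    G.str.mul_congr rfl (G.str.mul_inv_cancel_right _ _ l.2.2)]

theorem hpull_src_unit (p : HPullOb φ₁ φ₂) : hpullSrc (hpullUnit p) = p := by
  refine hpullOb_ext (G₁.str.src_unit _) ?_ (G₂.str.src_unit _)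
  dsimp only [hpullSrc, hpullUnit]
  exact (G.str.mul_congr rfl (φ₂.map_unit _) _).trans (G.str.mul_unit' _)

theorem hpull_tgt_unit (p : HPullOb φ₁ φ₂) : hpullTgt (hpullUnit p) = p := by
  refine hpullOb_ext (G₁.str.tgt_unit _) ?_ (G₂.str.tgt_unit _)
  dsimp only [hpullTgt, hpullUnit]
  exact (G.str.mul_congr (φ₁.map_unit _) rfl _).trans (G.str.unit_mul' _)

theorem hpull_src_inv (k : HPullAr φ₁ φ₂) : hpullSrc (hpullInv k) = hpullTgt k := by
  refine hpullOb_ext (G₁.str.src_inv _) ?_ (G₂.str.src_inv _)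
  dsimp only [hpullSrc, hpullTgt, hpullInv]
  exact (G.str.mul_congr (G.str.mul_assoc _ _ _ k.2.1 k.2.2).symm (φ₂.map_inv _) _).trans
    (G.str.mul_inv_cancel_right _ _ ((G.str.src_mul _ _ _).trans k.2.2))

theorem hpull_tgt_inv (k : HPullAr φ₁ φ₂) : hpullTgt (hpullInv k) = hpullSrc k := by
  refine hpullOb_ext (G₁.str.tgt_inv _) ?_ (G₂.str.tgt_inv _)
  dsimp only [hpullSrc, hpullTgt, hpullInv]
  exact (G.str.mul_congr (φ₁.map_inv _) rfl _).trans
    (G.str.inv_mul_cancel_left _ _ (hpull_inv_aux k))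

/-- The homotopy pullback `G₁ ×̃_G G₂` as a groupoid of sets. -/
def hpullStr : GroupoidStr (HPullOb φ₁ φ₂) (HPullAr φ₁ φ₂) where
  src := hpullSrc
  tgt := hpullTgt
  mul := hpullMul
  unit := hpullUnit
  inv := hpullInv
  src_mul := hpull_src_mul
  tgt_mul := hpull_tgt_mul
  src_unit := hpull_src_unit
  tgt_unit := hpull_tgt_unit
  src_inv := hpull_src_inv
  tgt_inv := hpull_tgt_inv
  mul_assoc j l k w w' := by
    refine hpullAr_ext (G₁.str.mul_assoc _ _ _ (hpull_comp₁ w) (hpull_comp₁ w')) ?_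
      (G₂.str.mul_assoc _ _ _ (hpull_comp₃ w) (hpull_comp₃ w'))
    dsimp only [hpullMul]
    have h3 : G.str.src (φ₂.ar j.1.2.2) = G.str.tgt (φ₂.ar l.1.2.2) := by
      rw [φ₂.src_ar, φ₂.tgt_ar, hpull_comp₃ w]
    rw [G.str.mul_assoc _ _ _ (hpull_mid w') (by rw [G.str.src_inv, G.str.tgt_inv, h3])]
    refine G.str.mul_congr rfl ?_ _
    rw [φ₂.map_mul, G.str.inv_mul_rev]
  mul_unit k := by
    refine hpullAr_ext (G₁.str.mul_unit _) ?_ (G₂.str.mul_unit _)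
    exact G.str.mul_inv_cancel_right _ _ k.2.2
  unit_mul k := by
    refine hpullAr_ext (G₁.str.unit_mul _) ?_ (G₂.str.unit_mul _)
    dsimp only [hpullMul, hpullUnit]
    exact (G.str.mul_congr rfl ((congrArg _ (φ₂.map_unit _)).trans (G.str.inv_unit _)) _).trans
      (G.str.mul_unit' _)
  mul_inv k := by
    refine hpullAr_ext (G₁.str.mul_inv _) ?_ (G₂.str.mul_inv _)
    dsimp only [hpullMul, hpullInv, hpullUnit, hpullTgt]
    exact (G.str.mul_congr (G.str.mul_assoc _ _ _ k.2.1 k.2.2).symm rfl _).trans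
      (G.str.mul_inv_cancel_right _ _ ((G.str.src_mul _ _ _).trans k.2.2))
  inv_mul k := by
    refine hpullAr_ext (G₁.str.inv_mul _) ?_ (G₂.str.inv_mul _)
    dsimp only [hpullMul, hpullInv, hpullUnit, hpullSrc]
    refine G.str.mul_congr rfl ?_ _
    rw [φ₂.map_inv, G.str.inv_inv]

variable (φ₁ φ₂) in
/-- A smooth structure exhibiting `G₁ ×̃_G G₂` as a Lie groupoid whose objects and arrows are the
good pullbacks of manifolds `M₁ ×_M G ×_M M₂` and `G₁ ×_M G ×_M G₂`; the homotopy pullback *exists*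
if there is such a structure. The topologies are the subspace topologies. -/
structure HomotopyPullback where
  dimOb : ℕ
  dimAr : ℕ
  [chartedOb : ChartedSpace (EuclideanSpace ℝ (Fin dimOb)) (HPullOb φ₁ φ₂)]
  [mfdOb : IsManifold (𝓡 dimOb) ∞ (HPullOb φ₁ φ₂)]
  [chartedAr : ChartedSpace (EuclideanSpace ℝ (Fin dimAr)) (HPullAr φ₁ φ₂)]
  [mfdAr : IsManifold (𝓡 dimAr) ∞ (HPullAr φ₁ φ₂)]
  /-- `(x₁, g, x₂)` with `φ₁(x₁) = t(g)` and `φ₂(x₂) = s(g)` -/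
  pullbackOb : IsGoodPullback (𝓡 dimOb) ((𝓡 G₁.dimOb).prod (𝓡 G₂.dimOb)) (𝓡 G.dimAr)
    ((𝓡 G.dimOb).prod (𝓡 G.dimOb))
    (fun p : HPullOb φ₁ φ₂ => (p.1.1, p.1.2.2)) (fun p : HPullOb φ₁ φ₂ => p.1.2.1)
    (Prod.map φ₁.ob φ₂.ob) G.str.anchor
  /-- `(k₁, k₂, k₃)` with `s(φ₁(k₁)) = t(k₂)` and `t(φ₂(k₃)) = s(k₂)` -/
  pullbackAr : IsGoodPullback (𝓡 dimAr) ((𝓡 G₁.dimAr).prod (𝓡 G₂.dimAr)) (𝓡 G.dimAr)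
    ((𝓡 G.dimOb).prod (𝓡 G.dimOb))
    (fun k : HPullAr φ₁ φ₂ => (k.1.1, k.1.2.2)) (fun k : HPullAr φ₁ φ₂ => k.1.2.1)
    (Prod.map (fun k₁ => G.str.src (φ₁.ar k₁)) (fun k₃ => G.str.tgt (φ₂.ar k₃))) G.str.anchor
  isLie : (hpullStr (φ₁ := φ₁) (φ₂ := φ₂)).IsLie dimOb dimAr

namespace HomotopyPullback

/-- The homotopy pullback as a Lie groupoid. -/
abbrev toLieGroupoid (P : HomotopyPullback φ₁ φ₂) : LieGroupoid.{u} :=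
  letI := P.chartedOb
  letI := P.chartedAr
  haveI := P.mfdOb
  haveI := P.mfdAr
  haveI : SecondCountableTopology (HPullOb φ₁ φ₂) :=
    TopologicalSpace.Subtype.secondCountableTopology _
  haveI : SecondCountableTopology (HPullAr φ₁ φ₂) :=
    TopologicalSpace.Subtype.secondCountableTopology _
  { Ob := HPullOb φ₁ φ₂
    Ar := HPullAr φ₁ φ₂
    dimOb := P.dimOb
    dimAr := P.dimAr
    str := hpullStr
    isLie := P.isLie }

/-- The base-change `φ̃₁ : G₁ ×̃_G G₂ → G₂` of `φ₁`, given by `(x₁, g, x₂) ↦ x₂` on objects and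
`(k₁, k₂, k₃) ↦ k₃` on arrows. -/
def baseChange (P : HomotopyPullback φ₁ φ₂) : Hom P.toLieGroupoid G₂ where
  ob p := p.1.2.2
  ar k := k.1.2.2
  smooth_ob := by
    let := P.chartedOb
    exact P.pullbackOb.smooth_left.snd
  smooth_ar := by
    let := P.chartedAr
    exact P.pullbackAr.smooth_left.snd
  src_ar _ := rfl
  tgt_ar _ := rfl
  map_mul _ _ _ := rfl

end HomotopyPullback

end HomotopyPullback

end LieGroupoid

/-!
Since `φ₁` is essentially surjective, every pair `(a, c)` of tangent vectors of `M` at the end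
points of an arrow is a sum of the image of a tangent vector of `G` under the anchor and a vector
`(dφ₁ v, 0)`. So `φ₁ × φ₂ : M₁ × M₂ → M × M` is transversal to the anchor, and the objects and the
arrows of the homotopy pullback are good pullbacks by the regular value theorem. Maps into a good
pullback are smooth as soon as their components are, so the structure maps are smooth. The arrows
with source `(x₁, g, x₂)` are the `(k₁, g φ₂(k₃)⁻¹, k₃)` with `s(k₁) = x₁` and `s(k₃) = x₂`; hence
a base change of the submersion `s × s` factors through the source map, which is therefore a
submersion.

An arrow from `a = (x₁, g, x₂)` to `b = (y₁, g', y₂)` is determined by its third component `k₃`: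
its middle component is `k₂ = g φ₂(k₃)⁻¹`, and `φ₁(k₁) = g' k₂⁻¹` determines `k₁`, smoothly in
`(k₃, b, a)`, because `φ₁` is fully faithful. So the base change is fully faithful too.
-/

section ModelDerivative

variable {𝕜 : Type*} [NontriviallyNormedField 𝕜]
  {E : Type*} [NormedAddCommGroup E] [NormedSpace 𝕜 E] {H : Type*} [TopologicalSpace H]
  {E' : Type*} [NormedAddCommGroup E'] [NormedSpace 𝕜 E'] {H' : Type*} [TopologicalSpace H']
  {E'' : Type*} [NormedAddCommGroup E''] [NormedSpace 𝕜 E''] {H'' : Type*} [TopologicalSpace H'']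
  {F : Type*} [NormedAddCommGroup F] [NormedSpace 𝕜 F] {K : Type*} [TopologicalSpace K]
  (I : ModelWithCorners 𝕜 E H) (I' : ModelWithCorners 𝕜 E' H') {I'' : ModelWithCorners 𝕜 E'' H''}
  {J : ModelWithCorners 𝕜 F K}
  {M M' M'' N : Type*} [TopologicalSpace M] [ChartedSpace H M] [TopologicalSpace M']
  [ChartedSpace H' M'] [TopologicalSpace M''] [ChartedSpace H'' M'']
  [TopologicalSpace N] [ChartedSpace K N]

/-- The derivative of a map of manifolds, as a map between the model spaces, so that its type does
not depend on the point. -/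
noncomputable def modelDeriv (f : M → M') (x : M) : E →L[𝕜] E' := mfderiv I I' f x

variable {I I'}

theorem modelDeriv_comp {g : M' → M''} {f : M → M'} {x : M} (hg : MDifferentiableAt I' I'' g (f x))
    (hf : MDifferentiableAt I I' f x) (v : E) :
    modelDeriv I I'' (fun z => g (f z)) x v = modelDeriv I' I'' g (f x) (modelDeriv I I' f x v) :=
  DFunLike.congr_fun (mfderiv_comp x hg hf) v

theorem modelDeriv_id {x : M} (v : E) : modelDeriv I I (fun z : M => z) x v = v :=
  DFunLike.congr_fun (mfderiv_id (I := I) (x := x)) v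

theorem modelDeriv_congr {f g : M → M'} {x : M} (h : f =ᶠ[𝓝 x] g) :
    modelDeriv I I' f x = modelDeriv I I' g x :=
  Filter.EventuallyEq.mfderiv_eq h

theorem modelDeriv_fst {x : M × N} (v : E × F) :
    modelDeriv (I.prod J) I (fun z : M × N => z.1) x v = v.1 :=
  DFunLike.congr_fun (hasMFDerivAt_fst x).mfderiv v

theorem modelDeriv_snd {x : M × N} (v : E × F) :
    modelDeriv (I.prod J) J (fun z : M × N => z.2) x v = v.2 :=
  DFunLike.congr_fun (hasMFDerivAt_snd x).mfderiv v

theorem modelDeriv_sub {f g : M → E'} {x : M} (hf : MDifferentiableAt I 𝓘(𝕜, E') f x)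
    (hg : MDifferentiableAt I 𝓘(𝕜, E') g x) (v : E) :
    modelDeriv I 𝓘(𝕜, E') (fun z => f z - g z) x v =
      modelDeriv I 𝓘(𝕜, E') f x v - modelDeriv I 𝓘(𝕜, E') g x v :=
  DFunLike.congr_fun (hf.hasMFDerivAt.sub hg.hasMFDerivAt).mfderiv v

theorem modelDeriv_comm_of_comp_eq {p : M → M'} {q : M → N}
    {f : M' → M''} {g : N → M''} (hf : MDifferentiable I' I'' f) (hg : MDifferentiable J I'' g)
    (hp : MDifferentiable I I' p) (hq : MDifferentiable I J q) (h : ∀ z, f (p z) = g (q z))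
    (x : M) (v : E) :
    modelDeriv I' I'' f (p x) (modelDeriv I I' p x v) =
      modelDeriv J I'' g (q x) (modelDeriv I J q x v) := by
  rw [← modelDeriv_comp (hf _) (hp x), ← modelDeriv_comp (hg _) (hq x), funext h]

theorem modelDeriv_prodMk {f : M → M'} {g : M → M''} {x : M} (hf : MDifferentiableAt I I' f x)
    (hg : MDifferentiableAt I I'' g x) (v : E) :
    modelDeriv I (I'.prod I'') (fun z => (f z, g z)) x v =
      (modelDeriv I I' f x v, modelDeriv I I'' g x v) :=
  DFunLike.congr_fun (mfderiv_prodMk hf hg) v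

theorem modelDeriv_prodMk_space {f : M → E'} {g : M → E''} {x : M}
    (hf : MDifferentiableAt I 𝓘(𝕜, E') f x) (hg : MDifferentiableAt I 𝓘(𝕜, E'') g x) (v : E) :
    modelDeriv I 𝓘(𝕜, E' × E'') (fun z => (f z, g z)) x v =
      (modelDeriv I 𝓘(𝕜, E') f x v, modelDeriv I 𝓘(𝕜, E'') g x v) := by
  rw [modelWithCornersSelf_prod, ← chartedSpaceSelf_prod]
  exact modelDeriv_prodMk hf hg v

theorem modelDeriv_prodMap {f : M → M'} {g : N → M''} {x : M × N}
    (hf : MDifferentiableAt I I' f x.1) (hg : MDifferentiableAt J I'' g x.2) (v : E × F) :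
    modelDeriv (I.prod J) (I'.prod I'') (Prod.map f g) x v =
      (modelDeriv I I' f x.1 v.1, modelDeriv J I'' g x.2 v.2) :=
  DFunLike.congr_fun (mfderiv_prodMap hf hg) v

theorem modelDeriv_extChartAt_self [IsManifold I 1 M] {x : M} (v : E) :
    modelDeriv I 𝓘(𝕜, E) (extChartAt I x) x v = v :=
  DFunLike.congr_fun (mfderiv_extChartAt_self (I := I) (x := x)) v

theorem modelDeriv_continuousLinearMap (L : E →L[𝕜] E') (x v : E) :
    modelDeriv 𝓘(𝕜, E) 𝓘(𝕜, E') L x v = L v :=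
  DFunLike.congr_fun (mfderiv_eq_fderiv.trans L.fderiv) v

theorem injective_modelDeriv_of_leftInverse {f : M → M'} {r : M' → M} {x : M}
    (hf : MDifferentiableAt I I' f x) (hr : MDifferentiableAt I' I r (f x))
    (h : ∀ᶠ z in 𝓝 x, r (f z) = z) : Function.Injective (modelDeriv I I' f x) := by
  refine Function.LeftInverse.injective (g := modelDeriv I' I r (f x)) fun v => ?_
  rw [← modelDeriv_comp hr hf, modelDeriv_congr h, modelDeriv_id]

theorem surjective_modelDeriv_of_comp {g : M' → M''} {f : M → M'} {x : M}
    (hg : MDifferentiableAt I' I'' g (f x)) (hf : MDifferentiableAt I I' f x)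
    (h : Function.Surjective (modelDeriv I I'' (fun z => g (f z)) x)) :
    Function.Surjective (modelDeriv I' I'' g (f x)) := fun w => by
  obtain ⟨v, rfl⟩ := h w
  exact ⟨modelDeriv I I' f x v, (modelDeriv_comp hg hf v).symm⟩

theorem surjective_modelDeriv_prodMap {f : M → M'} {g : N → M''} {x : M × N}
    (hf : MDifferentiableAt I I' f x.1) (hg : MDifferentiableAt J I'' g x.2)
    (hf' : Function.Surjective (modelDeriv I I' f x.1))
    (hg' : Function.Surjective (modelDeriv J I'' g x.2)) :
    Function.Surjective (modelDeriv (I.prod J) (I'.prod I'') (Prod.map f g) x) := by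
  rintro ⟨v, w⟩
  obtain ⟨v', rfl⟩ := hf' v
  obtain ⟨w', rfl⟩ := hg' w
  exact ⟨(v', w'), modelDeriv_prodMap hf hg (v', w')⟩

end ModelDerivative

section InverseFunction

variable {𝕜 : Type*} [RCLike 𝕜]
  {E : Type*} [NormedAddCommGroup E] [NormedSpace 𝕜 E]
  {V : Type*} [NormedAddCommGroup V] [NormedSpace 𝕜 V]
  {n : WithTop ℕ∞}

theorem isLocalDiffeomorphAt_of_hasFDerivAt_equiv [CompleteSpace E] {f : E → V} {U : Set E}
    (hU : IsOpen U) (hf : ContDiffOn 𝕜 n f U) (hn : n ≠ 0) {a : E} (ha : a ∈ U) {f' : E ≃L[𝕜] V}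
    (hf' : HasFDerivAt f (f' : E →L[𝕜] V) a) :
    IsLocalDiffeomorphAt 𝓘(𝕜, E) 𝓘(𝕜, V) n f a := by
  have hfa : ContDiffAt 𝕜 n f a := hf.contDiffAt (hU.mem_nhds ha)
  set W : Set E := U ∩ fderiv 𝕜 f ⁻¹' range ((↑) : (E ≃L[𝕜] V) → E →L[𝕜] V)
  have hdf : ContinuousOn (fderiv 𝕜 f) U :=
    hf.continuousOn_fderiv_of_isOpen hU (ENat.one_le_iff_ne_zero_withTop.2 hn)
  have hW : IsOpen W := hdf.isOpen_inter_preimage hU ContinuousLinearEquiv.isOpen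
  set e := (hfa.toOpenPartialHomeomorph f hf' hn).restrOpen W hW with he
  have he_source : e.source ⊆ W := fun x hx => by
    rw [he, OpenPartialHomeomorph.restrOpen_source] at hx
    exact hx.2
  have he_symm : ContDiffOn 𝕜 n e.symm e.target := fun y hy => by
    obtain ⟨hyU, L, hL⟩ := he_source (e.map_target hy)
    have hfy : ContDiffAt 𝕜 n f (e.symm y) := hf.contDiffAt (hU.mem_nhds hyU)
    refine (e.contDiffAt_symm hy (f₀' := L) ?_ hfy).contDiffWithinAt
    rw [hL]
    exact (hfy.differentiableAt hn).hasFDerivAt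
  refine ⟨⟨e.toPartialEquiv, e.open_source, e.open_target,
    (hf.mono fun x hx => (he_source hx).1).contMDiffOn, he_symm.contMDiffOn⟩, ?_, fun _ _ => rfl⟩
  change a ∈ e.source
  rw [he, OpenPartialHomeomorph.restrOpen_source]
  exact ⟨hfa.mem_toOpenPartialHomeomorph_source hf' hn, ha, f', hf'.fderiv.symm⟩

variable {H : Type*} [TopologicalSpace H] {I : ModelWithCorners 𝕜 E H} [I.Boundaryless]
  {N : Type*} [TopologicalSpace N] [ChartedSpace H N] [IsManifold I n N]

variable (n I) in
/-- The extended chart at a point of a manifold without boundary, as a partial diffeomorphism. -/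
noncomputable def extChartPartialDiffeomorph (a : N) : PartialDiffeomorph I 𝓘(𝕜, E) N E n where
  toPartialEquiv := extChartAt I a
  open_source := isOpen_extChartAt_source a
  open_target := isOpen_extChartAt_target a
  contMDiffOn_toFun := by
    rw [extChartAt_source]
    exact contMDiffOn_extChartAt
  contMDiffOn_invFun := contMDiffOn_extChartAt_symm a

theorem isLocalDiffeomorphAt_of_modelDeriv_eq [CompleteSpace E] {f : N → V} {U : Set N}
    (hU : IsOpen U) (hf : ContMDiffOn I 𝓘(𝕜, V) n f U) (hn : n ≠ 0) {a : N} (ha : a ∈ U)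
    {f' : E ≃L[𝕜] V} (hf' : modelDeriv I 𝓘(𝕜, V) f a = f') :
    IsLocalDiffeomorphAt I 𝓘(𝕜, V) n f a := by
  let φ := extChartPartialDiffeomorph n I a
  have hφU : IsOpen (φ.target ∩ φ.symm ⁻¹' U) :=
    φ.symm.toOpenPartialHomeomorph.isOpen_inter_preimage hU
  have hg : ContDiffOn 𝕜 n (f ∘ φ.symm) (φ.target ∩ φ.symm ⁻¹' U) :=
    (hf.comp (φ.symm.contMDiffOn.mono inter_subset_left) fun x hx => hx.2).contDiffOn
  have hφφa : φ.symm (φ a) = a := extChartAt_to_inv (I := I) a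
  have haφ : φ a ∈ φ.target ∩ φ.symm ⁻¹' U :=
    ⟨mem_extChartAt_target a, mem_preimage.2 (hφφa.symm ▸ ha)⟩
  have hg' : HasFDerivAt (f ∘ φ.symm) (f' : E →L[𝕜] V) (φ a) := by
    have hfa := ((hf.contMDiffAt (hU.mem_nhds ha)).mdifferentiableAt hn).hasMFDerivAt.2
    rw [I.range_eq_univ] at hfa
    exact hf' ▸ hasFDerivWithinAt_univ.1 hfa
  obtain ⟨Φ, haΦ, hΦ⟩ := isLocalDiffeomorphAt_of_hasFDerivAt_equiv hφU hg hn haφ hg'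
  refine ⟨φ.trans Φ, ⟨mem_extChartAt_source a, haΦ⟩, fun x hx => ?_⟩
  have : f (φ.symm (φ x)) = Φ (φ x) := hΦ hx.2
  rwa [show φ.symm (φ x) = x from φ.left_inv hx.1] at this

theorem exists_continuousLinearEquiv_prod_fst_eq [FiniteDimensional 𝕜 E] [FiniteDimensional 𝕜 V]
    {F : Type*} [NormedAddCommGroup F] [NormedSpace 𝕜 F] [FiniteDimensional 𝕜 F]
    {D : E →L[𝕜] V} (hD : Function.Surjective D)
    (hdim : Module.finrank 𝕜 E = Module.finrank 𝕜 V + Module.finrank 𝕜 F) :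
    ∃ L : E ≃L[𝕜] V × F, ∀ v, (L v).1 = D v := by
  have : CompleteSpace E := FiniteDimensional.complete 𝕜 E
  have : CompleteSpace V := FiniteDimensional.complete 𝕜 V
  have : CompleteSpace F := FiniteDimensional.complete 𝕜 F
  have hD_range : D.range = ⊤ := LinearMap.range_eq_top.2 hD
  have hker : Module.finrank 𝕜 D.ker = Module.finrank 𝕜 F := by
    have := LinearMap.finrank_range_add_finrank_ker (D : E →ₗ[𝕜] V)
    rw [hD_range, finrank_top] at this
    omega
  obtain ⟨Q, hQ⟩ := Submodule.exists_isCompl D.ker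
  let κ := LinearEquiv.ofFinrankEq _ _ hker
  let K : E →L[𝕜] F :=
    LinearMap.toContinuousLinearMap (κ.toLinearMap ∘ₗ Submodule.projectionOnto D.ker Q hQ)
  have hK_range : K.range = ⊤ :=
    LinearMap.range_eq_top.2 (κ.surjective.comp (Submodule.projectionOnto_surjective hQ))
  have hK_ker : K.ker = Q := by
    change LinearMap.ker (κ.toLinearMap ∘ₗ Submodule.projectionOnto D.ker Q hQ) = Q
    rw [LinearEquiv.ker_comp, Submodule.ker_projectionOnto]
  exact ⟨D.equivProdOfSurjectiveOfIsCompl K hD_range hK_range (by rwa [hK_ker]), fun _ => rfl⟩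

variable [FiniteDimensional 𝕜 E]

theorem exists_isLocalDiffeomorphAt_fst_eq [FiniteDimensional 𝕜 V]
    {F : Type*} [NormedAddCommGroup F] [NormedSpace 𝕜 F] [FiniteDimensional 𝕜 F]
    {h : N → V} {U : Set N} (hU : IsOpen U) (hh : ContMDiffOn I 𝓘(𝕜, V) n h U) (hn : n ≠ 0)
    {a : N} (ha : a ∈ U) (hs : Function.Surjective (modelDeriv I 𝓘(𝕜, V) h a))
    (hdim : Module.finrank 𝕜 E = Module.finrank 𝕜 V + Module.finrank 𝕜 F) :
    ∃ f : N → V × F, IsLocalDiffeomorphAt I 𝓘(𝕜, V × F) n f a ∧ ∀ x, (f x).1 = h x := by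
  have : CompleteSpace E := FiniteDimensional.complete 𝕜 E
  have : IsManifold I 1 N := .of_le (ENat.one_le_iff_ne_zero_withTop.2 hn)
  obtain ⟨L, hL⟩ := exists_continuousLinearEquiv_prod_fst_eq (F := F) hs hdim
  let K : E →L[𝕜] F := (ContinuousLinearMap.snd 𝕜 V F).comp (L : E →L[𝕜] V × F)
  let W : Set N := U ∩ (chartAt H a).source
  have haW : a ∈ W := ⟨ha, mem_chart_source H a⟩
  have hW : IsOpen W := hU.inter (chartAt H a).open_source
  have hK : ContMDiffOn I 𝓘(𝕜, F) n (fun x => K (extChartAt I a x)) W :=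
    K.contMDiff.comp_contMDiffOn (contMDiffOn_extChartAt.mono inter_subset_right)
  have hhW : ContMDiffOn I 𝓘(𝕜, V) n h W := hh.mono inter_subset_left
  refine ⟨fun x => (h x, K (extChartAt I a x)),
    isLocalDiffeomorphAt_of_modelDeriv_eq hW (hhW.prodMk_space hK) hn haW (f' := L) ?_,
    fun _ => rfl⟩
  ext1 v
  rw [modelDeriv_prodMk_space ((hhW.contMDiffAt (hW.mem_nhds haW)).mdifferentiableAt hn)
      ((hK.contMDiffAt (hW.mem_nhds haW)).mdifferentiableAt hn),
    modelDeriv_comp K.mdifferentiableAt (mdifferentiableAt_extChartAt (mem_chart_source H a)),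
    modelDeriv_extChartAt_self, modelDeriv_continuousLinearMap, ← hL]
  rfl

theorem exists_leftInverse_of_injective_modelDeriv {E' : Type*} [NormedAddCommGroup E']
    [NormedSpace 𝕜 E'] [FiniteDimensional 𝕜 E'] {H' : Type*} [TopologicalSpace H']
    {I' : ModelWithCorners 𝕜 E' H'} {N' : Type*} [TopologicalSpace N'] [ChartedSpace H' N']
    [IsManifold I' n N'] {f : N → N'} (hf : ContMDiff I I' n f) (hn : n ≠ 0) {a : N}
    (hi : Function.Injective (modelDeriv I I' f a)) :
    ∃ r : N' → N, ContMDiffAt I' I n r (f a) ∧ ∀ᶠ z in 𝓝 a, r (f z) = z := by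
  have : CompleteSpace E := FiniteDimensional.complete 𝕜 E
  have : IsManifold I' 1 N' := .of_le (ENat.one_le_iff_ne_zero_withTop.2 hn)
  obtain ⟨A, hA⟩ := (modelDeriv I I' f a : E →ₗ[𝕜] E').exists_leftInverse_of_injective
    (LinearMap.ker_eq_bot.2 hi)
  let A' : E' →L[𝕜] E := LinearMap.toContinuousLinearMap A
  let ψ : N' → E := fun y => A' (extChartAt I' (f a) y)
  have hψ : ContMDiffOn I' 𝓘(𝕜, E) n ψ (chartAt H' (f a)).source :=
    A'.contMDiff.comp_contMDiffOn contMDiffOn_extChartAt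
  have hψfa : ContMDiffAt I' 𝓘(𝕜, E) n ψ (f a) :=
    hψ.contMDiffAt ((chartAt H' (f a)).open_source.mem_nhds (mem_chart_source H' (f a)))
  have hψf : modelDeriv I 𝓘(𝕜, E) (fun z => ψ (f z)) a = ContinuousLinearEquiv.refl 𝕜 E := by
    ext1 v
    rw [modelDeriv_comp (hψfa.mdifferentiableAt hn) (hf.mdifferentiable hn a),
      modelDeriv_comp A'.mdifferentiableAt
        (mdifferentiableAt_extChartAt (mem_chart_source H' (f a))), modelDeriv_extChartAt_self,
      modelDeriv_continuousLinearMap]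
    exact LinearMap.congr_fun hA v
  obtain ⟨Φ, haΦ, hΦ⟩ := isLocalDiffeomorphAt_of_modelDeriv_eq
    ((chartAt H' (f a)).open_source.preimage hf.continuous)
    (hψ.comp hf.contMDiffOn fun x hx => hx) hn (mem_chart_source H' (f a)) hψf
  have hΦa : ψ (f a) ∈ Φ.target := by
    rw [show ψ (f a) = Φ a from hΦ haΦ]
    exact Φ.map_source haΦ
  refine ⟨fun y => Φ.symm (ψ y), ContMDiffAt.comp (f a) (g := Φ.symm)
    (Φ.symm.contMDiffOn.contMDiffAt (Φ.open_target.mem_nhds hΦa)) hψfa, ?_⟩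
  filter_upwards [Φ.open_source.mem_nhds haΦ] with z hz
  rw [show ψ (f z) = Φ z from hΦ hz]
  exact Φ.left_inv hz

end InverseFunction

section Submersion

variable {𝕜 : Type*} [RCLike 𝕜] {n : WithTop ℕ∞}
  {E : Type*} [NormedAddCommGroup E] [NormedSpace 𝕜 E]
  {E' : Type*} [NormedAddCommGroup E'] [NormedSpace 𝕜 E']
  {M : Type*} [TopologicalSpace M] [ChartedSpace E M]
  {N : Type*} [TopologicalSpace N] [ChartedSpace E' N]
  {f : M → N}

theorem surjective_modelDeriv_of_isSubmersionAt (hn : n ≠ 0) {x : M}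
    (hf : Manifold.IsSubmersionAt 𝓘(𝕜, E) 𝓘(𝕜, E') n f x) :
    Function.Surjective (modelDeriv 𝓘(𝕜, E) 𝓘(𝕜, E') f x) := by
  have hf' : MDifferentiableAt 𝓘(𝕜, E) 𝓘(𝕜, E') f x := hf.contMDiffAt.mdifferentiableAt hn
  let ψ := hf.codChart
  let φ := hf.domChart
  have hφ : φ.MDifferentiable 𝓘(𝕜, E) 𝓘(𝕜, E) :=
    ⟨(contMDiffOn_of_mem_maximalAtlas hf.domChart_mem_maximalAtlas).mdifferentiableOn hn,
      (contMDiffOn_symm_of_mem_maximalAtlas hf.domChart_mem_maximalAtlas).mdifferentiableOn hn⟩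
  have hψ : ψ.MDifferentiable 𝓘(𝕜, E') 𝓘(𝕜, E') :=
    ⟨(contMDiffOn_of_mem_maximalAtlas hf.codChart_mem_maximalAtlas).mdifferentiableOn hn,
      (contMDiffOn_symm_of_mem_maximalAtlas hf.codChart_mem_maximalAtlas).mdifferentiableOn hn⟩
  let L : E →L[𝕜] E' := (ContinuousLinearMap.fst 𝕜 E' hf.complement).comp
    (hf.equiv : E →L[𝕜] E' × hf.complement)
  have hψf : (fun z => ψ (f z)) =ᶠ[𝓝 x] fun z => L (φ z) := by
    filter_upwards [φ.open_source.mem_nhds hf.mem_domChart_source] with z hz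
    have : ψ (f (φ.symm (φ z))) = L (φ z) :=
      hf.writtenInCharts (by simpa using φ.map_source hz)
    rwa [φ.left_inv hz] at this
  have hφ_surj : Function.Surjective (modelDeriv 𝓘(𝕜, E) 𝓘(𝕜, E) φ x) :=
    hφ.mfderiv_surjective hf.mem_domChart_source
  have hψ_inj : Function.Injective (modelDeriv 𝓘(𝕜, E') 𝓘(𝕜, E') ψ (f x)) :=
    hψ.mfderiv_injective hf.mem_codChart_source
  intro v
  obtain ⟨w, hw⟩ := hf.equiv.surjective (modelDeriv 𝓘(𝕜, E') 𝓘(𝕜, E') ψ (f x) v, 0)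
  obtain ⟨u, rfl⟩ := hφ_surj w
  refine ⟨u, hψ_inj ?_⟩
  rw [← modelDeriv_comp (hψ.mdifferentiableAt hf.mem_codChart_source) hf', modelDeriv_congr hψf,
    modelDeriv_comp L.mdifferentiableAt (hφ.mdifferentiableAt hf.mem_domChart_source),
    modelDeriv_continuousLinearMap]
  exact congrArg Prod.fst hw

variable [FiniteDimensional 𝕜 E] [FiniteDimensional 𝕜 E'] [IsManifold 𝓘(𝕜, E) n M]
  [IsManifold 𝓘(𝕜, E') n N]

theorem isSubmersionAtOfComplement_of_surjective_modelDeriv (F : Type*) [NormedAddCommGroup F]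
    [NormedSpace 𝕜 F] [FiniteDimensional 𝕜 F]
    (hdim : Module.finrank 𝕜 E = Module.finrank 𝕜 E' + Module.finrank 𝕜 F)
    (hf : ContMDiff 𝓘(𝕜, E) 𝓘(𝕜, E') n f) (hn : n ≠ 0) {x : M}
    (hs : Function.Surjective (modelDeriv 𝓘(𝕜, E) 𝓘(𝕜, E') f x)) :
    Manifold.IsSubmersionAtOfComplement F 𝓘(𝕜, E) 𝓘(𝕜, E') n f x := by
  have : IsManifold 𝓘(𝕜, E') 1 N := .of_le (ENat.one_le_iff_ne_zero_withTop.2 hn)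
  let L : E ≃L[𝕜] E' × F := ContinuousLinearEquiv.ofFinrankEq (by rw [hdim, Module.finrank_prod])
  let ψ := chartAt E' (f x)
  have hψf : ContMDiffOn 𝓘(𝕜, E) 𝓘(𝕜, E') n (fun z => extChartAt 𝓘(𝕜, E') (f x) (f z))
      (f ⁻¹' ψ.source) :=
    contMDiffOn_extChartAt.comp hf.contMDiffOn fun x hx => hx
  have hψf' : Function.Surjective
      (modelDeriv 𝓘(𝕜, E) 𝓘(𝕜, E') (fun z => extChartAt 𝓘(𝕜, E') (f x) (f z)) x) := fun v => by
    obtain ⟨w, rfl⟩ := hs v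
    refine ⟨w, ?_⟩
    rw [modelDeriv_comp (mdifferentiableAt_extChartAt (mem_chart_source _ (f x)))
      (hf.mdifferentiable hn x), modelDeriv_extChartAt_self]
  obtain ⟨g, ⟨Φ, hxΦ, hΦ⟩, hg⟩ := exists_isLocalDiffeomorphAt_fst_eq
    (ψ.open_source.preimage hf.continuous) hψf hn (mem_chart_source _ (f x)) hψf' hdim
  let e : OpenPartialHomeomorph M E :=
    Φ.toOpenPartialHomeomorph.trans L.symm.toHomeomorph.toOpenPartialHomeomorph
  have he_source : e.source = Φ.source := by simp [e]
  have he_target : e.target = L ⁻¹' Φ.target := by ext; simp [e]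
  refine .mk_of_continuousAt hf.continuous.continuousAt L e ψ (by rwa [he_source])
    (mem_chart_source _ _) (e.mem_maximalAtlas_of_contMDiffOn ?_ ?_)
    (IsManifold.chart_mem_maximalAtlas _) ?_
  · rw [he_source]
    exact L.symm.contDiff.contMDiff.comp_contMDiffOn Φ.contMDiffOn
  · rw [he_target]
    exact Φ.symm.contMDiffOn.comp L.contDiff.contMDiff.contMDiffOn fun y hy => hy
  · intro y hy
    have hLy : L y ∈ Φ.target := by simpa [he_target] using hy
    have : Φ (Φ.symm (L y)) = L y := Φ.right_inv hLy
    rw [← hΦ (Φ.symm.map_source hLy)] at this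
    exact (hg _).symm.trans (congrArg Prod.fst this)

end Submersion

theorem isSubmersion_of_surjective_modelDeriv {m k : ℕ}
    {M : Type*} [TopologicalSpace M] [ChartedSpace (EuclideanSpace ℝ (Fin m)) M]
    {N : Type*} [TopologicalSpace N] [ChartedSpace (EuclideanSpace ℝ (Fin k)) N]
    [IsManifold (𝓡 m) ∞ M] [IsManifold (𝓡 k) ∞ N] {f : M → N} (hf : ContMDiff (𝓡 m) (𝓡 k) ∞ f)
    (hs : ∀ x, Function.Surjective (modelDeriv (𝓡 m) (𝓡 k) f x)) :
    Manifold.IsSubmersion (𝓡 m) (𝓡 k) ∞ f := by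
  refine ⟨EuclideanSpace ℝ (Fin (m - k)), inferInstance, inferInstance, fun x => ?_⟩
  have hkm : k ≤ m := by
    simpa using LinearMap.finrank_le_finrank_of_surjective
      (f := (modelDeriv (𝓡 m) (𝓡 k) f x).toLinearMap) (hs x)
  exact isSubmersionAtOfComplement_of_surjective_modelDeriv _ (by simp [hkm]) hf (by simp) (hs x)

section Submanifold

variable {𝕜 : Type*} [RCLike 𝕜] {n : WithTop ℕ∞}
  {E : Type*} [NormedAddCommGroup E] [NormedSpace 𝕜 E] {H : Type*} [TopologicalSpace H]
  {I : ModelWithCorners 𝕜 E H} {F : Type*} [NormedAddCommGroup F] [NormedSpace 𝕜 F]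
  {P : Type*} [TopologicalSpace P] {N : Type*} [TopologicalSpace N] [ChartedSpace H N]
  {ι : P → N}

variable (n I) in
/-- A chart of `P` that is compatible with the `C^n` structure of `N` via `ι : P → N`: its inverse
is `C^n` as a map to `N`, and it is the restriction of a map `r` that is `C^n` near `ι z` for all
`z` in the domain of the chart. -/
def IsSubmanifoldChart (ι : P → N) (e : OpenPartialHomeomorph P F) : Prop :=
  ContMDiffOn 𝓘(𝕜, F) I n (ι ∘ e.symm) e.target ∧
    ∃ r : N → F, ∀ z ∈ e.source, ContMDiffAt I 𝓘(𝕜, F) n r (ι z) ∧ r (ι z) = e z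

theorem IsSubmanifoldChart.contDiffOn_trans {e e' : OpenPartialHomeomorph P F}
    (he : IsSubmanifoldChart n I ι e) (he' : IsSubmanifoldChart n I ι e') :
    ContDiffOn 𝕜 n (e.symm.trans e') (e.symm.trans e').source := by
  obtain ⟨r, hr⟩ := he'.2
  rw [OpenPartialHomeomorph.trans_source]
  intro y hy
  refine ContMDiffWithinAt.contDiffWithinAt (.congr_of_mem (f := r ∘ (ι ∘ e.symm)) ?_ ?_ hy)
  · exact (hr _ hy.2).1.comp_contMDiffWithinAt y ((he.1 y hy.1).mono inter_subset_left)
  · exact fun y hy => (hr _ hy.2).2.symm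

theorem exists_isManifold_of_isSubmanifoldChart (hn : n ≠ 0)
    (h : ∀ z, ∃ e : OpenPartialHomeomorph P F, IsSubmanifoldChart n I ι e ∧ z ∈ e.source) :
    ∃ (_ : ChartedSpace F P) (_ : IsManifold 𝓘(𝕜, F) n P),
      ContMDiff 𝓘(𝕜, F) I n ι ∧ ∀ z, Function.Injective (modelDeriv 𝓘(𝕜, F) I ι z) := by
  choose c hc hzc using h
  let cs : ChartedSpace F P :=
    { atlas := {e | IsSubmanifoldChart n I ι e}
      chartAt := c
      mem_chart_source := hzc
      chart_mem_atlas := hc }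
  have hm : IsManifold 𝓘(𝕜, F) n P :=
    isManifold_of_contDiffOn _ _ _ fun e e' he he' => by
      simpa using he.contDiffOn_trans he'
  have hι : ContMDiff 𝓘(𝕜, F) I n ι := fun z => by
    have : ContMDiffOn 𝓘(𝕜, F) I n ((ι ∘ (c z).symm) ∘ c z) (c z).source :=
      (hc z).1.comp (contMDiffOn_chart (x := z)) fun y hy => (c z).map_source hy
    refine (this.congr fun y hy => ?_).contMDiffAt ((c z).open_source.mem_nhds (hzc z))
    simp [(c z).left_inv hy]
  refine ⟨cs, hm, hι, fun z => ?_⟩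
  obtain ⟨r, hr⟩ := (hc z).2
  have hsymm : ContMDiffAt 𝓘(𝕜, F) 𝓘(𝕜, F) n (c z).symm (r (ι z)) := by
    rw [(hr z (hzc z)).2]
    exact (contMDiffOn_chart_symm (x := z)).contMDiffAt
      ((c z).open_target.mem_nhds ((c z).map_source (hzc z)))
  refine injective_modelDeriv_of_leftInverse (r := (c z).symm ∘ r) ((hι z).mdifferentiableAt hn)
    ((hsymm.comp (ι z) (hr z (hzc z)).1).mdifferentiableAt hn) ?_
  filter_upwards [(c z).open_source.mem_nhds (hzc z)] with y hy
  rw [Function.comp_apply, (hr y hy).2, (c z).left_inv hy]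

variable {V : Type*} [NormedAddCommGroup V] [NormedSpace 𝕜 V]

theorem exists_isSubmanifoldChart_of_slice [Nonempty P] (hι : IsEmbedding ι)
    {Φ : OpenPartialHomeomorph N (V × F)} (hΦ : ContMDiffOn I 𝓘(𝕜, V × F) n Φ Φ.source)
    (hΦ_symm : ContMDiffOn 𝓘(𝕜, V × F) I n Φ.symm Φ.target)
    (hrange : ∀ y ∈ Φ.source, y ∈ range ι ↔ (Φ y).1 = 0) :
    ∃ e : OpenPartialHomeomorph P F, IsSubmanifoldChart n I ι e ∧ e.source = ι ⁻¹' Φ.source := by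
  have hΦι : ∀ z ∈ ι ⁻¹' Φ.source, ((0 : V), (Φ (ι z)).2) = Φ (ι z) := fun z hz =>
    Prod.ext ((hrange _ hz).1 ⟨z, rfl⟩).symm rfl
  have hslice : ContMDiff 𝓘(𝕜, F) 𝓘(𝕜, V × F) n fun u : F => ((0 : V), u) :=
    contMDiff_const.prodMk_space contMDiff_id
  have hinv : ∀ u, ((0 : V), u) ∈ Φ.target →
      ι (Function.invFun ι (Φ.symm (0, u))) = Φ.symm (0, u) := fun u hu =>
    Function.invFun_eq ((hrange _ (Φ.map_target hu)).2 (by rw [Φ.right_inv hu]))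
  have hι_symm : ContMDiffOn 𝓘(𝕜, F) I n (fun u => ι (Function.invFun ι (Φ.symm (0, u))))
      {u | ((0 : V), u) ∈ Φ.target} :=
    (hΦ_symm.comp hslice.contMDiffOn fun u hu => hu).congr hinv
  have hsnd : ContMDiffOn I 𝓘(𝕜, F) n (fun y => (Φ y).2) Φ.source :=
    (ContinuousLinearMap.snd 𝕜 V F).contMDiff.comp_contMDiffOn hΦ
  let e : OpenPartialHomeomorph P F :=
    { toFun := fun z => (Φ (ι z)).2
      invFun := fun u => Function.invFun ι (Φ.symm (0, u))
      source := ι ⁻¹' Φ.source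
      target := {u | ((0 : V), u) ∈ Φ.target}
      map_source' := fun z hz => by
        rw [mem_ofPred_eq, hΦι z hz]
        exact Φ.map_source hz
      map_target' := fun u hu => by
        rw [mem_preimage, hinv u hu]
        exact Φ.map_target hu
      left_inv' := fun z hz => by
        rw [hΦι z hz, Φ.left_inv hz, Function.leftInverse_invFun hι.injective z]
      right_inv' := fun u hu => by rw [hinv u hu, Φ.right_inv hu]
      open_source := Φ.open_source.preimage hι.continuous
      open_target := Φ.open_target.preimage hslice.continuous
      continuousOn_toFun := hsnd.continuousOn.comp hι.continuous.continuousOn fun y hy => hy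
      continuousOn_invFun := hι.isInducing.continuousOn_iff.2 hι_symm.continuousOn }
  exact ⟨e, ⟨hι_symm, _, fun z hz => ⟨hsnd.contMDiffAt (Φ.open_source.mem_nhds hz), rfl⟩⟩, rfl⟩

variable [FiniteDimensional 𝕜 E] [IsManifold I n N]

theorem exists_isSubmanifoldChart_of_regular [I.Boundaryless] [FiniteDimensional 𝕜 F]
    [FiniteDimensional 𝕜 V]
    (hι : IsEmbedding ι) (hn : n ≠ 0) {z : P} {U : Set N} (hU : IsOpen U) (hz : ι z ∈ U) {k : N → V}
    (hk : ContMDiffOn I 𝓘(𝕜, V) n k U)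
    (hk_surj : Function.Surjective (modelDeriv I 𝓘(𝕜, V) k (ι z)))
    (hrange : ∀ y ∈ U, y ∈ range ι ↔ k y = 0)
    (hdim : Module.finrank 𝕜 E = Module.finrank 𝕜 V + Module.finrank 𝕜 F) :
    ∃ e : OpenPartialHomeomorph P F, IsSubmanifoldChart n I ι e ∧ z ∈ e.source := by
  have : Nonempty P := ⟨z⟩
  obtain ⟨f, ⟨Φ, hzΦ, hΦ⟩, hf⟩ := exists_isLocalDiffeomorphAt_fst_eq hU hk hn hz hk_surj hdim
  let Ψ := Φ.toOpenPartialHomeomorph.restrOpen U hU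
  have hΨ_source : Ψ.source = Φ.source ∩ U := Φ.toOpenPartialHomeomorph.restrOpen_source U hU
  have hΨ_target : Ψ.target ⊆ Φ.target := inter_subset_left
  obtain ⟨e, he, he_source⟩ := exists_isSubmanifoldChart_of_slice hι (Φ := Ψ)
    (Φ.contMDiffOn.mono (hΨ_source ▸ inter_subset_left)) (Φ.symm.contMDiffOn.mono hΨ_target)
    fun y hy => by
      rw [hΨ_source] at hy
      rw [hrange y hy.2, ← hf, hΦ hy.1]
      rfl
  exact ⟨e, he, by rw [he_source, mem_preimage, hΨ_source]; exact ⟨hzΦ, hz⟩⟩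

theorem contMDiffOn_of_comp_embedding {E₀ : Type*} [NormedAddCommGroup E₀] [NormedSpace 𝕜 E₀]
    [FiniteDimensional 𝕜 E₀] {H₀ : Type*} [TopologicalSpace H₀] {I₀ : ModelWithCorners 𝕜 E₀ H₀}
    [I₀.Boundaryless] [ChartedSpace H₀ P] [IsManifold I₀ n P] (hn : n ≠ 0)
    (hι : ContMDiff I₀ I n ι) (hemb : IsEmbedding ι)
    (hinj : ∀ z, Function.Injective (modelDeriv I₀ I ι z))
    {E' : Type*} [NormedAddCommGroup E'] [NormedSpace 𝕜 E'] {H' : Type*} [TopologicalSpace H']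
    {J : ModelWithCorners 𝕜 E' H'} {Z : Type*} [TopologicalSpace Z] [ChartedSpace H' Z]
    {c : Z → P} {S : Set Z} (hc : ContMDiffOn J I n (fun z => ι (c z)) S) :
    ContMDiffOn J I₀ n c S := by
  intro z hz
  have hcont : ContinuousWithinAt c S z :=
    hemb.isInducing.continuousWithinAt_iff.2 (hc.continuousOn z hz)
  obtain ⟨r, hr, hrι⟩ := exists_leftInverse_of_injective_modelDeriv hι hn (hinj (c z))
  refine (hr.comp_contMDiffWithinAt z (hc z hz)).congr_of_eventuallyEq ?_ ?_
  · filter_upwards [hcont.eventually hrι] with y hy using hy.symm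
  · exact hrι.self_of_nhds.symm

end Submanifold

section GoodPullback

variable
  {EP : Type*} [NormedAddCommGroup EP] [NormedSpace ℝ EP] {HP : Type*} [TopologicalSpace HP]
  {EX : Type*} [NormedAddCommGroup EX] [NormedSpace ℝ EX] {HX : Type*} [TopologicalSpace HX]
  {EY : Type*} [NormedAddCommGroup EY] [NormedSpace ℝ EY] {HY : Type*} [TopologicalSpace HY]
  {EB : Type*} [NormedAddCommGroup EB] [NormedSpace ℝ EB] {HB : Type*} [TopologicalSpace HB]
  {EW : Type*} [NormedAddCommGroup EW] [NormedSpace ℝ EW] {HW : Type*} [TopologicalSpace HW]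
  {IP : ModelWithCorners ℝ EP HP} {IX : ModelWithCorners ℝ EX HX}
  {IY : ModelWithCorners ℝ EY HY} {IB : ModelWithCorners ℝ EB HB} {IW : ModelWithCorners ℝ EW HW}
  {P X Y B W : Type u}
  [TopologicalSpace P] [ChartedSpace HP P] [TopologicalSpace X] [ChartedSpace HX X]
  [TopologicalSpace Y] [ChartedSpace HY Y] [TopologicalSpace B] [ChartedSpace HB B]
  [TopologicalSpace W] [ChartedSpace HW W]
  {p : P → X} {q : P → Y} {f : X → B} {g : Y → B} {a : W → X} {b : W → Y}

namespace IsGoodPullback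

theorem existsUnique_modelDeriv (h : IsGoodPullback IP IX IY IB p q f g) (z : P) {v : EX} {w : EY}
    (e : modelDeriv IX IB f (p z) v = modelDeriv IY IB g (q z) w) :
    ∃! t : EP, modelDeriv IP IX p z t = v ∧ modelDeriv IP IY q z t = w :=
  h.tangent z v w e

theorem injective_modelDeriv (h : IsGoodPullback IP IX IY IB p q f g) (z : P) :
    Function.Injective (modelDeriv IP (IX.prod IY) (fun z => (p z, q z)) z) := by
  intro t t' ht
  have hp := (h.smooth_left z).mdifferentiableAt (by simp)
  have hq := (h.smooth_right z).mdifferentiableAt (by simp)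
  rw [modelDeriv_prodMk hp hq, modelDeriv_prodMk hp hq, Prod.mk.injEq] at ht
  exact (h.existsUnique_modelDeriv z (h.tangent_comm z t')).unique ht ⟨rfl, rfl⟩

theorem surjective_modelDeriv_right (h : IsGoodPullback IP IX IY IB p q f g) {z : P}
    (hf : Function.Surjective (modelDeriv IX IB f (p z))) :
    Function.Surjective (modelDeriv IP IY q z) := fun w => by
  obtain ⟨v, hv⟩ := hf (modelDeriv IY IB g (q z) w)
  obtain ⟨t, ht, -⟩ := h.existsUnique_modelDeriv z hv
  exact ⟨t, ht.2⟩

theorem eq_of_eq (h : IsGoodPullback IP IX IY IB p q f g) {z z' : P} (hp : p z = p z')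
    (hq : q z = q z') : z = z' :=
  h.embedding.injective (Prod.ext hp hq)

theorem exists_of_eq (h : IsGoodPullback IP IX IY IB p q f g) {x : X} {y : Y} (e : f x = g y) :
    ∃ z, p z = x ∧ q z = y := by
  have hxy : (x, y) ∈ range fun z => (p z, q z) := h.range_eq ▸ e
  exact hxy.imp fun z hz => Prod.ext_iff.1 hz

theorem comp_diffeomorph (h : IsGoodPullback IW IX IY IB a b f g) (η : P ≃ₘ^∞⟮IP, IW⟯ W) :
    IsGoodPullback IP IX IY IB (fun z => a (η z)) (fun z => b (η z)) f g := by
  have hη : MDifferentiable IP IW η := η.contMDiff.mdifferentiable (by simp)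
  have haη : ∀ z t, modelDeriv IP IX (fun z => a (η z)) z t =
      modelDeriv IW IX a (η z) (modelDeriv IP IW η z t) := fun z =>
    modelDeriv_comp ((h.smooth_left _).mdifferentiableAt (by simp)) (hη z)
  have hbη : ∀ z t, modelDeriv IP IY (fun z => b (η z)) z t =
      modelDeriv IW IY b (η z) (modelDeriv IP IW η z t) := fun z =>
    modelDeriv_comp ((h.smooth_right _).mdifferentiableAt (by simp)) (hη z)
  have hbij : ∀ z, Function.Bijective (modelDeriv IP IW η z) := fun z =>
    (η.mfderivToContinuousLinearEquiv (by simp) z).bijective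
  refine ⟨h.smooth_left.comp η.contMDiff, h.smooth_right.comp η.contMDiff, fun z => h.comm (η z),
    ?_, h.embedding.comp η.toHomeomorph.isEmbedding,
    (η.surjective.range_comp _).trans h.range_eq, fun z t => ?_, fun z v w e => ?_⟩
  · intro n Z _ _ _ _ _ x y hx hy hxy
    obtain ⟨c, ⟨hc, hac, hbc⟩, huniq⟩ := h.lift n Z x y hx hy hxy
    refine ⟨η.symm ∘ c, ⟨η.symm.contMDiff.comp hc, by simpa using hac, by simpa using hbc⟩,
      fun c' ⟨hc', hac', hbc'⟩ => funext fun z => ?_⟩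
    rw [← huniq (η ∘ c') ⟨η.contMDiff.comp hc', hac', hbc'⟩]
    exact (η.symm_apply_apply _).symm
  · exact (congrArg _ (haη z t)).trans ((h.tangent_comm _ _).trans (congrArg _ (hbη z t).symm))
  · change ∃! t : EP, modelDeriv IP IX (fun z => a (η z)) z t = v ∧
      modelDeriv IP IY (fun z => b (η z)) z t = w
    simp only [haη, hbη]
    obtain ⟨t', ht', huniq⟩ := h.existsUnique_modelDeriv (η z) e
    obtain ⟨t, rfl⟩ := (hbij z).2 t'
    exact ⟨t, ht', fun s hs => (hbij z).1 (huniq _ hs)⟩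

variable [FiniteDimensional ℝ EX] [FiniteDimensional ℝ EY] [IsManifold IX ∞ X] [IsManifold IY ∞ Y]

section

variable [FiniteDimensional ℝ EP] [IP.Boundaryless] [IsManifold IP ∞ P]
  {E' : Type*} [NormedAddCommGroup E'] [NormedSpace ℝ E'] {H' : Type*} [TopologicalSpace H']
  {J : ModelWithCorners ℝ E' H'} {Z : Type*} [TopologicalSpace Z] [ChartedSpace H' Z]

theorem contMDiffOn (h : IsGoodPullback IP IX IY IB p q f g) {c : Z → P} {S : Set Z}
    (hp : ContMDiffOn J IX ∞ (fun z => p (c z)) S) (hq : ContMDiffOn J IY ∞ (fun z => q (c z)) S) :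
    ContMDiffOn J IP ∞ c S :=
  contMDiffOn_of_comp_embedding (by simp) (h.smooth_left.prodMk h.smooth_right) h.embedding
    h.injective_modelDeriv (hp.prodMk hq)

theorem contMDiff (h : IsGoodPullback IP IX IY IB p q f g) {c : Z → P}
    (hp : ContMDiff J IX ∞ fun z => p (c z)) (hq : ContMDiff J IY ∞ fun z => q (c z)) :
    ContMDiff J IP ∞ c :=
  contMDiffOn_univ.1 (h.contMDiffOn hp.contMDiffOn hq.contMDiffOn)

theorem of_embedding (hf : ContMDiff IX IB ∞ f) (hg : ContMDiff IY IB ∞ g)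
    (hpq : ContMDiff IP (IX.prod IY) ∞ fun z => (p z, q z))
    (hemb : IsEmbedding fun z => (p z, q z))
    (hrange : range (fun z => (p z, q z)) = {w : X × Y | f w.1 = g w.2})
    (hinj : ∀ z, Function.Injective (modelDeriv IP (IX.prod IY) (fun z => (p z, q z)) z))
    (hex : ∀ z v w, modelDeriv IX IB f (p z) v = modelDeriv IY IB g (q z) w →
      ∃ t, modelDeriv IP (IX.prod IY) (fun z => (p z, q z)) z t = (v, w)) :
    IsGoodPullback IP IX IY IB p q f g := by
  have hcomm : ∀ z, f (p z) = g (q z) := range_subset_iff.1 hrange.subset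
  have hp : ContMDiff IP IX ∞ p := hpq.fst
  have hq : ContMDiff IP IY ∞ q := hpq.snd
  have hd : ∀ z t, modelDeriv IP (IX.prod IY) (fun z => (p z, q z)) z t =
      (modelDeriv IP IX p z t, modelDeriv IP IY q z t) := fun z =>
    modelDeriv_prodMk ((hp z).mdifferentiableAt (by simp)) ((hq z).mdifferentiableAt (by simp))
  have htan : ∀ z (v : EX) (w : EY), modelDeriv IX IB f (p z) v = modelDeriv IY IB g (q z) w →
      ∃! t : EP, modelDeriv IP IX p z t = v ∧ modelDeriv IP IY q z t = w := fun z v w e => by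
    simp_rw [← Prod.mk_inj, ← hd]
    exact (hinj z).existsUnique_of_mem_range (hex z v w e)
  refine ⟨hp, hq, hcomm, ?_, hemb, hrange, modelDeriv_comm_of_comp_eq (hf.mdifferentiable (by simp))
    (hg.mdifferentiable (by simp)) (hp.mdifferentiable (by simp)) (hq.mdifferentiable (by simp))
    hcomm, htan⟩
  intro n Z _ _ _ _ _ x y hx hy hxy
  have hmem : ∀ z, (x z, y z) ∈ range fun z => (p z, q z) := fun z => hrange ▸ hxy z
  choose c hc using hmem
  refine ⟨c, ⟨?_, fun z => congrArg Prod.fst (hc z), fun z => congrArg Prod.snd (hc z)⟩,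
    fun c' ⟨_, hpc', hqc'⟩ =>
      funext fun z => hemb.injective ((Prod.ext (hpc' z) (hqc' z)).trans (hc z).symm)⟩
  exact contMDiffOn_univ.1 <| contMDiffOn_of_comp_embedding (by simp) hpq hemb hinj
    ((hx.prodMk hy).congr hc).contMDiffOn

end

theorem of_inverse [IW.Boundaryless] [FiniteDimensional ℝ EW] [IsManifold IW ∞ W]
    (h : IsGoodPullback IW IX IY IB a b f g)
    (hp : ContMDiff IP IX ∞ p) (hq : ContMDiff IP IY ∞ q) (hcomm : ∀ z, f (p z) = g (q z))
    (hinj : Function.Injective fun z => (p z, q z)) {θ : W → P} (hθ : ContMDiff IW IP ∞ θ)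
    (hpθ : ∀ w, p (θ w) = a w) (hqθ : ∀ w, q (θ w) = b w) :
    IsGoodPullback IP IX IY IB p q f g := by
  choose η haη hbη using fun z => h.exists_of_eq (hcomm z)
  have hη : ContMDiff IP IW ∞ η := h.contMDiff (by simpa only [haη]) (by simpa only [hbη])
  let η' : P ≃ₘ^∞⟮IP, IW⟯ W :=
    { toFun := η
      invFun := θ
      left_inv := fun z => hinj (by simp only [hpθ, hqθ, haη, hbη])
      right_inv := fun w => h.eq_of_eq (by rw [haη, hpθ]) (by rw [hbη, hqθ])
      contMDiff_toFun := hη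
      contMDiff_invFun := hθ }
  have := h.comp_diffeomorph η'
  rwa [show (fun z => a (η' z)) = p from funext haη,
    show (fun z => b (η' z)) = q from funext hbη] at this

end IsGoodPullback

end GoodPullback

theorem range_eq_ker_of_finrank_eq_add {K U V W : Type*} [DivisionRing K] [AddCommGroup U]
    [Module K U] [AddCommGroup V] [Module K V] [FiniteDimensional K V] [AddCommGroup W] [Module K W]
    {T : U →ₗ[K] V} {D : V →ₗ[K] W} (hT : Function.Injective T) (hD : Function.Surjective D)
    (hDT : ∀ u, D (T u) = 0) (hdim : Module.finrank K V = Module.finrank K W + Module.finrank K U) :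
    LinearMap.range T = LinearMap.ker D := by
  refine Submodule.eq_of_le_of_finrank_eq (LinearMap.range_le_ker_iff.2 (LinearMap.ext hDT)) ?_
  have hDker := D.finrank_range_add_finrank_ker
  rw [LinearMap.range_eq_top.2 hD, finrank_top] at hDker
  rw [LinearMap.finrank_range_of_inj hT]
  omega

section Transversality

variable {𝕜 : Type*} [NontriviallyNormedField 𝕜]
  {EX : Type*} [NormedAddCommGroup EX] [NormedSpace 𝕜 EX] {HX : Type*} [TopologicalSpace HX]
  {EY : Type*} [NormedAddCommGroup EY] [NormedSpace 𝕜 EY] {HY : Type*} [TopologicalSpace HY]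
  {EB : Type*} [NormedAddCommGroup EB] [NormedSpace 𝕜 EB] {HB : Type*} [TopologicalSpace HB]
  {EZ : Type*} [NormedAddCommGroup EZ] [NormedSpace 𝕜 EZ] {HZ : Type*} [TopologicalSpace HZ]
  {IX : ModelWithCorners 𝕜 EX HX} {IY : ModelWithCorners 𝕜 EY HY}
  {IB : ModelWithCorners 𝕜 EB HB} {IZ : ModelWithCorners 𝕜 EZ HZ}
  {X Y B Z : Type*} [TopologicalSpace X] [ChartedSpace HX X] [TopologicalSpace Y]
  [ChartedSpace HY Y] [TopologicalSpace B] [ChartedSpace HB B] [TopologicalSpace Z]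
  [ChartedSpace HZ Z] {f : X → B} {g : Y → B}

theorem modelDeriv_extChartAt_sub [IsManifold IB 1 B] {x : X} {y : Y}
    (hf : MDifferentiableAt IX IB f x) (hg : MDifferentiableAt IY IB g y) (e : f x = g y)
    (v : EX) (w : EY) :
    modelDeriv (IX.prod IY) 𝓘(𝕜, EB)
        (fun z : X × Y => extChartAt IB (f x) (f z.1) - extChartAt IB (f x) (g z.2)) (x, y) (v, w) =
      modelDeriv IX IB f x v - modelDeriv IY IB g y w := by
  have hχf : MDifferentiableAt IB 𝓘(𝕜, EB) (extChartAt IB (f x)) (f x) :=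
    mdifferentiableAt_extChartAt (mem_chart_source HB (f x))
  have hχg : MDifferentiableAt IB 𝓘(𝕜, EB) (extChartAt IB (f x)) (g y) := e ▸ hχf
  have hf' : MDifferentiableAt (IX.prod IY) IB (fun z : X × Y => f z.1) (x, y) :=
    hf.comp (x, y) mdifferentiableAt_fst
  have hg' : MDifferentiableAt (IX.prod IY) IB (fun z : X × Y => g z.2) (x, y) :=
    hg.comp (x, y) mdifferentiableAt_snd
  have hχf' : MDifferentiableAt (IX.prod IY) 𝓘(𝕜, EB)
      (fun z : X × Y => extChartAt IB (f x) (f z.1)) (x, y) := hχf.comp (x, y) hf'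
  have hχg' : MDifferentiableAt (IX.prod IY) 𝓘(𝕜, EB)
      (fun z : X × Y => extChartAt IB (f x) (g z.2)) (x, y) := hχg.comp (x, y) hg'
  have hχ_id : ∀ u, modelDeriv IB 𝓘(𝕜, EB) (extChartAt IB (f x)) (g y) u = u := fun u => by
    rw [← e, modelDeriv_extChartAt_self]
  rw [modelDeriv_sub hχf' hχg', modelDeriv_comp (f := fun z : X × Y => f z.1) hχf hf',
    modelDeriv_comp (f := fun z : X × Y => g z.2) hχg hg', modelDeriv_extChartAt_self, hχ_id,
    modelDeriv_comp (f := Prod.fst) hf mdifferentiableAt_fst, modelDeriv_fst,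
    modelDeriv_comp (f := Prod.snd) hg mdifferentiableAt_snd, modelDeriv_snd]

variable (IX IY IB) in
/-- Two maps are transversal if the images of their derivatives at the points of the fibre product
span the tangent space of the base. -/
def IsTransversal (f : X → B) (g : Y → B) : Prop :=
  ∀ x y, f x = g y → ∀ b : EB, ∃ (v : EX) (w : EY),
    modelDeriv IX IB f x v - modelDeriv IY IB g y w = b

namespace IsTransversal

theorem of_surjective_left (hf : ∀ x, Function.Surjective (modelDeriv IX IB f x)) :
    IsTransversal IX IY IB f g := fun x y _ b => by
  obtain ⟨v, hv⟩ := hf x b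
  exact ⟨v, 0, by rw [hv, map_zero, sub_zero]⟩

theorem of_surjective_right (hg : ∀ y, Function.Surjective (modelDeriv IY IB g y)) :
    IsTransversal IX IY IB f g := fun x y _ b => by
  obtain ⟨w, hw⟩ := hg y (-b)
  exact ⟨0, w, by rw [hw, map_zero, zero_sub, neg_neg]⟩

theorem comp_left (h : IsTransversal IX IY IB f g) (hf : MDifferentiable IX IB f) {π : Z → X}
    (hπ : MDifferentiable IZ IX π) (hπ' : ∀ z, Function.Surjective (modelDeriv IZ IX π z)) :
    IsTransversal IZ IY IB (fun z => f (π z)) g := fun z y e b => by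
  obtain ⟨v, w, hvw⟩ := h (π z) y e b
  obtain ⟨t, rfl⟩ := hπ' z v
  exact ⟨t, w, by rw [modelDeriv_comp (hf _) (hπ z), hvw]⟩

theorem surjective_coprod (h : IsTransversal IX IY IB f g) {x : X} {y : Y} (e : f x = g y) :
    Function.Surjective ((modelDeriv IX IB f x).coprod (-modelDeriv IY IB g y)) := fun b => by
  obtain ⟨v, w, hvw⟩ := h x y e b
  exact ⟨(v, w), by simp [← hvw, sub_eq_add_neg]⟩

theorem finrank_le [FiniteDimensional 𝕜 EX] [FiniteDimensional 𝕜 EY]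
    (h : IsTransversal IX IY IB f g) {x : X} {y : Y} (e : f x = g y) :
    Module.finrank 𝕜 EB ≤ Module.finrank 𝕜 EX + Module.finrank 𝕜 EY := by
  rw [← Module.finrank_prod]
  exact LinearMap.finrank_le_finrank_of_surjective
    (f := ((modelDeriv IX IB f x).coprod (-modelDeriv IY IB g y)).toLinearMap)
    (h.surjective_coprod e)

theorem exists_modelDeriv_prodMk_eq [FiniteDimensional 𝕜 EX] [FiniteDimensional 𝕜 EY]
    (h : IsTransversal IX IY IB f g) (hf : MDifferentiable IX IB f) (hg : MDifferentiable IY IB g)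
    {p : Z → X} {q : Z → Y} (hp : MDifferentiable IZ IX p) (hq : MDifferentiable IZ IY q)
    (hcomm : ∀ z, f (p z) = g (q z)) {z : Z}
    (hinj : Function.Injective (modelDeriv IZ (IX.prod IY) (fun z => (p z, q z)) z))
    (hdim : Module.finrank 𝕜 (EX × EY) = Module.finrank 𝕜 EB + Module.finrank 𝕜 EZ) {v : EX}
    {w : EY} (e : modelDeriv IX IB f (p z) v = modelDeriv IY IB g (q z) w) :
    ∃ t, modelDeriv IZ (IX.prod IY) (fun z => (p z, q z)) z t = (v, w) := by
  let T := modelDeriv IZ (IX.prod IY) (fun z => (p z, q z)) z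
  let D := (modelDeriv IX IB f (p z)).coprod (-modelDeriv IY IB g (q z))
  have hDT : ∀ t, D (T t) = 0 := fun t => by
    simp [D, T, modelDeriv_prodMk (hp z) (hq z), modelDeriv_comm_of_comp_eq hf hg hp hq hcomm z t]
  have hmem : (v, w) ∈ LinearMap.ker D.toLinearMap := by simp [D, e]
  rwa [← range_eq_ker_of_finrank_eq_add (T := T.toLinearMap) hinj
    (h.surjective_coprod (hcomm z)) hDT hdim] at hmem

variable {n : WithTop ℕ∞} [IsManifold IB n B]

theorem exists_localEquation (h : IsTransversal IX IY IB f g) (hn : n ≠ 0)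
    (hf : ContMDiff IX IB n f) (hg : ContMDiff IY IB n g) {x : X} {y : Y} (e : f x = g y) :
    ∃ (U : Set (X × Y)) (k : X × Y → EB), IsOpen U ∧ (x, y) ∈ U ∧
      ContMDiffOn (IX.prod IY) 𝓘(𝕜, EB) n k U ∧
      Function.Surjective (modelDeriv (IX.prod IY) 𝓘(𝕜, EB) k (x, y)) ∧
      ∀ w ∈ U, k w = 0 ↔ f w.1 = g w.2 := by
  have : IsManifold IB 1 B := .of_le (ENat.one_le_iff_ne_zero_withTop.2 hn)
  let χ := extChartAt IB (f x)
  let C := (chartAt HB (f x)).source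
  have hC : IsOpen C := (chartAt HB (f x)).open_source
  have hxC : f x ∈ C := mem_chart_source HB (f x)
  have hχ : ContMDiffOn IB 𝓘(𝕜, EB) n χ C := contMDiffOn_extChartAt
  refine ⟨{w | f w.1 ∈ C ∧ g w.2 ∈ C}, fun w => χ (f w.1) - χ (g w.2),
    (hC.preimage (hf.continuous.comp continuous_fst)).inter
      (hC.preimage (hg.continuous.comp continuous_snd)), ⟨hxC, e ▸ hxC⟩,
    (hχ.comp (hf.comp contMDiff_fst).contMDiffOn fun w hw => hw.1).sub
      (hχ.comp (hg.comp contMDiff_snd).contMDiffOn fun w hw => hw.2), fun b => ?_, fun w hw => ?_⟩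
  · obtain ⟨v, w, hvw⟩ := h x y e b
    exact ⟨(v, w), (modelDeriv_extChartAt_sub ((hf x).mdifferentiableAt hn)
      ((hg y).mdifferentiableAt hn) e v w).trans hvw⟩
  · rw [sub_eq_zero]
    refine χ.injOn.eq_iff ?_ ?_
    · exact (extChartAt_source IB (f x)).symm ▸ hw.1
    · exact (extChartAt_source IB (f x)).symm ▸ hw.2

end IsTransversal

end Transversality

section TransversalPullback

variable
  {EX : Type*} [NormedAddCommGroup EX] [NormedSpace ℝ EX] [FiniteDimensional ℝ EX]
  {EY : Type*} [NormedAddCommGroup EY] [NormedSpace ℝ EY] [FiniteDimensional ℝ EY]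
  {EB : Type*} [NormedAddCommGroup EB] [NormedSpace ℝ EB] [FiniteDimensional ℝ EB]
  {HX : Type*} [TopologicalSpace HX] {HY : Type*} [TopologicalSpace HY]
  {HB : Type*} [TopologicalSpace HB] {IX : ModelWithCorners ℝ EX HX} [IX.Boundaryless]
  {IY : ModelWithCorners ℝ EY HY} [IY.Boundaryless] {IB : ModelWithCorners ℝ EB HB}
  {P X Y B : Type u} [TopologicalSpace P]
  [TopologicalSpace X] [ChartedSpace HX X] [IsManifold IX ∞ X]
  [TopologicalSpace Y] [ChartedSpace HY Y] [IsManifold IY ∞ Y]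
  [TopologicalSpace B] [ChartedSpace HB B] [IsManifold IB ∞ B]
  {p : P → X} {q : P → Y} {f : X → B} {g : Y → B}

namespace IsTransversal

theorem exists_isSubmanifoldChart (h : IsTransversal IX IY IB f g) (hf : ContMDiff IX IB ∞ f)
    (hg : ContMDiff IY IB ∞ g) (hemb : IsEmbedding fun z => (p z, q z))
    (hrange : range (fun z => (p z, q z)) = {w : X × Y | f w.1 = g w.2})
    {F : Type*} [NormedAddCommGroup F] [NormedSpace ℝ F] [FiniteDimensional ℝ F]
    (hdim : Module.finrank ℝ (EX × EY) = Module.finrank ℝ EB + Module.finrank ℝ F) (z : P) :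
    ∃ e : OpenPartialHomeomorph P F,
      IsSubmanifoldChart ∞ (IX.prod IY) (fun z => (p z, q z)) e ∧ z ∈ e.source := by
  obtain ⟨U, k, hU, hzU, hk, hk_surj, hk_zero⟩ :=
    h.exists_localEquation (by simp) hf hg (range_subset_iff.1 hrange.subset z)
  refine exists_isSubmanifoldChart_of_regular hemb (by simp) hU hzU hk hk_surj (fun w hw => ?_) hdim
  rw [hrange, hk_zero w hw]
  rfl

theorem exists_isGoodPullback (h : IsTransversal IX IY IB f g) (hf : ContMDiff IX IB ∞ f)
    (hg : ContMDiff IY IB ∞ g) (hemb : IsEmbedding fun z => (p z, q z))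
    (hrange : range (fun z => (p z, q z)) = {w : X × Y | f w.1 = g w.2}) :
    ∃ (n : ℕ) (_ : ChartedSpace (EuclideanSpace ℝ (Fin n)) P) (_ : IsManifold (𝓡 n) ∞ P),
      IsGoodPullback (𝓡 n) IX IY IB p q f g := by
  let n := Module.finrank ℝ EX + Module.finrank ℝ EY - Module.finrank ℝ EB
  have hdim : ∀ _ : P, Module.finrank ℝ (EX × EY) =
      Module.finrank ℝ EB + Module.finrank ℝ (EuclideanSpace ℝ (Fin n)) := fun z => by
    have := h.finrank_le (range_subset_iff.1 hrange.subset z)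
    rw [Module.finrank_prod, finrank_euclideanSpace_fin]
    omega
  obtain ⟨cs, hm, hpq, hinj⟩ := exists_isManifold_of_isSubmanifoldChart (by simp) fun z =>
    h.exists_isSubmanifoldChart hf hg hemb hrange (hdim z) z
  exact ⟨n, cs, hm, .of_embedding hf hg hpq hemb hrange hinj fun z v w e =>
    h.exists_modelDeriv_prodMk_eq (hf.mdifferentiable (by simp)) (hg.mdifferentiable (by simp))
      (hpq.fst.mdifferentiable (by simp)) (hpq.snd.mdifferentiable (by simp))
      (range_subset_iff.1 hrange.subset) (hinj z) (hdim z) e⟩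

theorem exists_isGoodPullback_subtype (h : IsTransversal IX IY IB f g) (hf : ContMDiff IX IB ∞ f)
    (hg : ContMDiff IY IB ∞ g) :
    ∃ (n : ℕ) (_ : ChartedSpace (EuclideanSpace ℝ (Fin n)) {w : X × Y // f w.1 = g w.2})
      (_ : IsManifold (𝓡 n) ∞ {w : X × Y // f w.1 = g w.2}),
      IsGoodPullback (𝓡 n) IX IY IB (fun w : {w : X × Y // f w.1 = g w.2} => w.1.1)
        (fun w => w.1.2) f g :=
  h.exists_isGoodPullback hf hg IsEmbedding.subtypeVal Subtype.range_val

end IsTransversal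

end TransversalPullback

theorem GroupoidStr.mul_right_cancel {M G : Type u} (S : GroupoidStr M G) {g g' h : G}
    (w : S.src g = S.tgt h) (w' : S.src g' = S.tgt h) (e : S.mul g h w = S.mul g' h w') :
    g = g' := by
  rw [← S.mul_inv_cancel_right g h w, S.mul_congr e rfl, S.mul_inv_cancel_right]

namespace LieGroupoid

section

variable (G : LieGroupoid.{u})

theorem contMDiff_src : ContMDiff (𝓡 G.dimAr) (𝓡 G.dimOb) ∞ G.str.src :=
  G.isLie.src_submersion.contMDiff

theorem contMDiff_tgt : ContMDiff (𝓡 G.dimAr) (𝓡 G.dimOb) ∞ G.str.tgt :=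
  G.isLie.tgt_submersion.contMDiff

theorem contMDiff_anchor :
    ContMDiff (𝓡 G.dimAr) ((𝓡 G.dimOb).prod (𝓡 G.dimOb)) ∞ G.str.anchor :=
  G.contMDiff_tgt.prodMk G.contMDiff_src

theorem mdifferentiable_src : MDifferentiable (𝓡 G.dimAr) (𝓡 G.dimOb) G.str.src :=
  G.contMDiff_src.mdifferentiable (by simp)

theorem mdifferentiable_tgt : MDifferentiable (𝓡 G.dimAr) (𝓡 G.dimOb) G.str.tgt :=
  G.contMDiff_tgt.mdifferentiable (by simp)

theorem surjective_modelDeriv_src (g : G.Ar) :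
    Function.Surjective (modelDeriv (𝓡 G.dimAr) (𝓡 G.dimOb) G.str.src g) :=
  surjective_modelDeriv_of_isSubmersionAt (by simp) (G.isLie.src_submersion.isSubmersionAt g)

theorem surjective_modelDeriv_tgt (g : G.Ar) :
    Function.Surjective (modelDeriv (𝓡 G.dimAr) (𝓡 G.dimOb) G.str.tgt g) :=
  surjective_modelDeriv_of_isSubmersionAt (by simp) (G.isLie.tgt_submersion.isSubmersionAt g)

theorem modelDeriv_anchor (g : G.Ar) (v : EuclideanSpace ℝ (Fin G.dimAr)) :
    modelDeriv (𝓡 G.dimAr) ((𝓡 G.dimOb).prod (𝓡 G.dimOb)) G.str.anchor g v =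
      (modelDeriv (𝓡 G.dimAr) (𝓡 G.dimOb) G.str.tgt g v,
        modelDeriv (𝓡 G.dimAr) (𝓡 G.dimOb) G.str.src g v) :=
  modelDeriv_prodMk (G.mdifferentiable_tgt g) (G.mdifferentiable_src g) v

variable {G} {E : Type*} [NormedAddCommGroup E] [NormedSpace ℝ E] {H : Type*} [TopologicalSpace H]
  {J : ModelWithCorners ℝ E H} {Z : Type*} [TopologicalSpace Z] [ChartedSpace H Z]

theorem contMDiffOn_of_eq_mul {a b c : Z → G.Ar} {S : Set Z}
    (ha : ContMDiffOn J (𝓡 G.dimAr) ∞ a S) (hb : ContMDiffOn J (𝓡 G.dimAr) ∞ b S)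
    (w : ∀ z ∈ S, G.str.src (a z) = G.str.tgt (b z))
    (hc : ∀ z (hz : z ∈ S), c z = G.str.mul (a z) (b z) (w z hz)) :
    ContMDiffOn J (𝓡 G.dimAr) ∞ c S := by
  obtain ⟨F, hF, hFm⟩ := G.isLie.smooth_mul
  exact (hF.comp (ha.prodMk hb) w).congr fun z hz => (hc z hz).trans (hFm _ _ _).symm

theorem contMDiff_mul {a b : Z → G.Ar} (ha : ContMDiff J (𝓡 G.dimAr) ∞ a)
    (hb : ContMDiff J (𝓡 G.dimAr) ∞ b) (w : ∀ z, G.str.src (a z) = G.str.tgt (b z)) :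
    ContMDiff J (𝓡 G.dimAr) ∞ (fun z => G.str.mul (a z) (b z) (w z)) :=
  contMDiffOn_univ.1 (contMDiffOn_of_eq_mul ha.contMDiffOn hb.contMDiffOn (fun z _ => w z)
    fun _ _ => rfl)

end

theorem Hom.IsEssentiallySurjective.exists_modelDeriv_tgt_eq_and_src_eq {A B : LieGroupoid.{u}}
    {φ : Hom A B} (h : φ.IsEssentiallySurjective) {g : B.Ar} {x : A.Ob}
    (e : B.str.tgt g = φ.ob x) (b : EuclideanSpace ℝ (Fin B.dimOb)) :
    ∃ (w : EuclideanSpace ℝ (Fin B.dimAr)) (v : EuclideanSpace ℝ (Fin A.dimOb)),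
      modelDeriv (𝓡 B.dimAr) (𝓡 B.dimOb) B.str.tgt g w =
        modelDeriv (𝓡 A.dimOb) (𝓡 B.dimOb) φ.ob x v ∧
      modelDeriv (𝓡 B.dimAr) (𝓡 B.dimOb) B.str.src g w = b := by
  obtain ⟨n, _, _, hpull, -, hsub⟩ := h
  obtain ⟨g', rfl⟩ : ∃ g', B.str.inv g' = g := ⟨B.str.inv g, B.str.inv_inv g⟩
  let z : φ.ArrowsFrom := ⟨(g', x), (B.str.tgt_inv g').symm.trans e⟩
  obtain ⟨τ, hτ⟩ := surjective_modelDeriv_of_isSubmersionAt (by simp) (hsub.isSubmersionAt z) b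
  rw [modelDeriv_comp (B.mdifferentiable_tgt _)
    ((hpull.smooth_left z).mdifferentiableAt (by simp))] at hτ
  have hinv : MDifferentiable (𝓡 B.dimAr) (𝓡 B.dimAr) B.str.inv :=
    B.isLie.smooth_inv.mdifferentiable (by simp)
  refine ⟨modelDeriv (𝓡 B.dimAr) (𝓡 B.dimAr) B.str.inv g'
    (modelDeriv (𝓡 n) (𝓡 B.dimAr) (fun p : φ.ArrowsFrom => p.1.1) z τ),
    modelDeriv (𝓡 n) (𝓡 A.dimOb) (fun p : φ.ArrowsFrom => p.1.2) z τ, ?_, ?_⟩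
  · rw [← modelDeriv_comp (B.mdifferentiable_tgt _) (hinv _), funext B.str.tgt_inv]
    exact hpull.tangent_comm z τ
  · rw [← modelDeriv_comp (B.mdifferentiable_src _) (hinv _), funext B.str.src_inv]
    exact hτ

section HomotopyPullback

variable {G G₁ G₂ : LieGroupoid.{u}} {φ₁ : Hom G₁ G} {φ₂ : Hom G₂ G}

theorem Hom.IsEssentiallySurjective.isTransversal (h : φ₁.IsEssentiallySurjective)
    (φ₂ : Hom G₂ G) :
    IsTransversal ((𝓡 G₁.dimOb).prod (𝓡 G₂.dimOb)) (𝓡 G.dimAr) ((𝓡 G.dimOb).prod (𝓡 G.dimOb))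
      (Prod.map φ₁.ob φ₂.ob) G.str.anchor := by
  rintro ⟨x₁, x₂⟩ g e ⟨a, c⟩
  obtain ⟨w₀, hw₀⟩ := G.surjective_modelDeriv_tgt g (-a)
  obtain ⟨w, v, hwv, hw⟩ := h.exists_modelDeriv_tgt_eq_and_src_eq (congrArg Prod.fst e).symm
    (-c - modelDeriv (𝓡 G.dimAr) (𝓡 G.dimOb) G.str.src g w₀)
  refine ⟨(v, 0), w₀ + w, ?_⟩
  rw [modelDeriv_prodMap ((φ₁.smooth_ob _).mdifferentiableAt (by simp))
    ((φ₂.smooth_ob _).mdifferentiableAt (by simp)), modelDeriv_anchor, map_add, map_add, hw₀, hw,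
    hwv, map_zero]
  ext1
  · simp
  · simp

theorem Hom.IsEssentiallySurjective.isTransversal_arrows (h : φ₁.IsEssentiallySurjective)
    (φ₂ : Hom G₂ G) :
    IsTransversal ((𝓡 G₁.dimAr).prod (𝓡 G₂.dimAr)) (𝓡 G.dimAr) ((𝓡 G.dimOb).prod (𝓡 G.dimOb))
      (Prod.map (fun k₁ => G.str.src (φ₁.ar k₁)) (fun k₃ => G.str.tgt (φ₂.ar k₃)))
      G.str.anchor := by
  simp only [φ₁.src_ar, φ₂.tgt_ar]
  exact (h.isTransversal φ₂).comp_left (π := Prod.map G₁.str.src G₂.str.tgt)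
    ((φ₁.smooth_ob.prodMap φ₂.smooth_ob).mdifferentiable (by simp))
    (G₁.mdifferentiable_src.prodMap G₂.mdifferentiable_tgt) fun k =>
    surjective_modelDeriv_prodMap (G₁.mdifferentiable_src _) (G₂.mdifferentiable_tgt _)
      (G₁.surjective_modelDeriv_src _) (G₂.surjective_modelDeriv_tgt _)

/-- The reordering of the factors of a triple product which matches the triples of a homotopy
pullback with the product that `IsGoodPullback` is formulated for. -/
def tripleHomeomorph (X Y Z : Type*) [TopologicalSpace X] [TopologicalSpace Y]
    [TopologicalSpace Z] : X × Y × Z ≃ₜ (X × Z) × Y where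
  toFun p := ((p.1, p.2.2), p.2.1)
  invFun p := (p.1.1, p.2, p.1.2)
  left_inv _ := rfl
  right_inv _ := rfl
  continuous_toFun := by fun_prop
  continuous_invFun := by fun_prop

theorem isEmbedding_hpullOb :
    IsEmbedding fun p : HPullOb φ₁ φ₂ => ((p.1.1, p.1.2.2), p.1.2.1) :=
  (tripleHomeomorph _ _ _).isEmbedding.comp IsEmbedding.subtypeVal

theorem isEmbedding_hpullAr :
    IsEmbedding fun k : HPullAr φ₁ φ₂ => ((k.1.1, k.1.2.2), k.1.2.1) :=
  (tripleHomeomorph _ _ _).isEmbedding.comp IsEmbedding.subtypeVal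

theorem range_hpullOb :
    range (fun p : HPullOb φ₁ φ₂ => ((p.1.1, p.1.2.2), p.1.2.1)) =
      {w | Prod.map φ₁.ob φ₂.ob w.1 = G.str.anchor w.2} := by
  refine Subset.antisymm ?_ fun w hw => ?_
  · rintro _ ⟨p, rfl⟩
    exact Prod.ext p.2.1.symm p.2.2.symm
  · exact ⟨⟨(w.1.1, w.2, w.1.2), (congrArg Prod.fst hw).symm, (congrArg Prod.snd hw).symm⟩, rfl⟩

theorem range_hpullAr :
    range (fun k : HPullAr φ₁ φ₂ => ((k.1.1, k.1.2.2), k.1.2.1)) =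
      {w | Prod.map (fun k₁ => G.str.src (φ₁.ar k₁)) (fun k₃ => G.str.tgt (φ₂.ar k₃)) w.1 =
        G.str.anchor w.2} := by
  refine Subset.antisymm ?_ fun w hw => ?_
  · rintro _ ⟨p, rfl⟩
    exact Prod.ext p.2.1 p.2.2.symm
  · exact ⟨⟨(w.1.1, w.2, w.1.2), congrArg Prod.fst hw, (congrArg Prod.snd hw).symm⟩, rfl⟩

theorem src_eq_tgt_inv_of_src_eq {a : HPullOb φ₁ φ₂} {k₃ : G₂.Ar} (h₃ : G₂.str.src k₃ = a.1.2.2) :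
    G.str.src a.1.2.1 = G.str.tgt (G.str.inv (φ₂.ar k₃)) := by
  rw [G.str.tgt_inv, φ₂.src_ar, h₃, a.2.2]

/-- The arrow `(k₁, k₂, k₃)` of the homotopy pullback that has source `a = (x₁, g, x₂)`: since
`k₂ φ₂(k₃) = g`, its middle component is `g φ₂(k₃)⁻¹`. -/
def hpullArOfSrc (k₁ : G₁.Ar) (k₃ : G₂.Ar) (a : HPullOb φ₁ φ₂) (h₁ : G₁.str.src k₁ = a.1.1)
    (h₃ : G₂.str.src k₃ = a.1.2.2) : HPullAr φ₁ φ₂ :=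
  ⟨(k₁, G.str.mul a.1.2.1 (G.str.inv (φ₂.ar k₃)) (src_eq_tgt_inv_of_src_eq h₃), k₃),
    by rw [φ₁.src_ar, h₁, G.str.tgt_mul, a.2.1], by rw [G.str.src_mul, G.str.src_inv]⟩

theorem hpullSrc_hpullArOfSrc {k₁ : G₁.Ar} {k₃ : G₂.Ar} {a : HPullOb φ₁ φ₂}
    (h₁ : G₁.str.src k₁ = a.1.1) (h₃ : G₂.str.src k₃ = a.1.2.2) :
    hpullSrc (hpullArOfSrc k₁ k₃ a h₁ h₃) = a :=
  hpullOb_ext h₁ (G.str.inv_mul_cancel_right _ _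
    ((src_eq_tgt_inv_of_src_eq h₃).trans (G.str.tgt_inv _))) h₃

theorem hpullArOfSrc_hpullSrc (k : HPullAr φ₁ φ₂) :
    hpullArOfSrc k.1.1 k.1.2.2 (hpullSrc k) rfl rfl = k :=
  hpullAr_ext rfl (G.str.mul_inv_cancel_right _ _ k.2.2) rfl

theorem Hom.IsFullyFaithful.hpullAr_ext (h : φ₁.IsFullyFaithful) {k l : HPullAr φ₁ φ₂}
    (hs : hpullSrc k = hpullSrc l) (ht : hpullTgt k = hpullTgt l) (h₃ : k.1.2.2 = l.1.2.2) :
    k = l := by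
  have hs₂ : G.str.mul k.1.2.1 (φ₂.ar k.1.2.2) k.2.2 = G.str.mul l.1.2.1 (φ₂.ar l.1.2.2) l.2.2 :=
    congrArg (fun p : HPullOb φ₁ φ₂ => p.1.2.1) hs
  have ht₂ : G.str.mul (φ₁.ar k.1.1) k.1.2.1 k.2.1 = G.str.mul (φ₁.ar l.1.1) l.1.2.1 l.2.1 :=
    congrArg (fun p : HPullOb φ₁ φ₂ => p.1.2.1) ht
  have h₂ : k.1.2.1 = l.1.2.1 := G.str.mul_right_cancel k.2.2 (by rw [l.2.2, h₃])
    (hs₂.trans (G.str.mul_congr rfl (congrArg _ h₃.symm) _))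
  have h₁ : φ₁.ar k.1.1 = φ₁.ar l.1.1 := G.str.mul_right_cancel k.2.1 (by rw [l.2.1, h₂])
    (ht₂.trans (G.str.mul_congr rfl h₂.symm _))
  refine LieGroupoid.hpullAr_ext (h.eq_of_eq h₁ (Prod.ext ?_ ?_)) h₂ h₃
  · exact congrArg (fun p : HPullOb φ₁ φ₂ => p.1.1) ht
  · exact congrArg (fun p : HPullOb φ₁ φ₂ => p.1.1) hs

theorem src_eq_tgt_inv_of_tgt_eq {b : HPullOb φ₁ φ₂} {k₂ : G.Ar} {k₃ : G₂.Ar}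
    (h₂ : G.str.src k₂ = G.str.tgt (φ₂.ar k₃)) (h₃ : G₂.str.tgt k₃ = b.1.2.2) :
    G.str.src b.1.2.1 = G.str.tgt (G.str.inv k₂) := by
  rw [G.str.tgt_inv, h₂, φ₂.tgt_ar, h₃, b.2.2]

variable (φ₁ φ₂) in
/-- The smooth structure makes the objects of the homotopy pullback the good pullback
`M₁ ×_M G ×_M M₂`, written as the fibre product of `φ₁ × φ₂` and the anchor of `G`. -/
abbrev IsObjectPullback (d : ℕ) [ChartedSpace (EuclideanSpace ℝ (Fin d)) (HPullOb φ₁ φ₂)] : Prop :=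
  IsGoodPullback (𝓡 d) ((𝓡 G₁.dimOb).prod (𝓡 G₂.dimOb)) (𝓡 G.dimAr)
    ((𝓡 G.dimOb).prod (𝓡 G.dimOb))
    (fun p : HPullOb φ₁ φ₂ => (p.1.1, p.1.2.2)) (fun p : HPullOb φ₁ φ₂ => p.1.2.1)
    (Prod.map φ₁.ob φ₂.ob) G.str.anchor

variable (φ₁ φ₂) in
/-- The smooth structure makes the arrows of the homotopy pullback the good pullback
`G₁ ×_M G ×_M G₂`, written as the fibre product of `(s ∘ φ₁) × (t ∘ φ₂)` and the anchor of `G`. -/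
abbrev IsArrowPullback (d : ℕ) [ChartedSpace (EuclideanSpace ℝ (Fin d)) (HPullAr φ₁ φ₂)] : Prop :=
  IsGoodPullback (𝓡 d) ((𝓡 G₁.dimAr).prod (𝓡 G₂.dimAr)) (𝓡 G.dimAr)
    ((𝓡 G.dimOb).prod (𝓡 G.dimOb))
    (fun k : HPullAr φ₁ φ₂ => (k.1.1, k.1.2.2)) (fun k : HPullAr φ₁ φ₂ => k.1.2.1)
    (Prod.map (fun k₁ => G.str.src (φ₁.ar k₁)) (fun k₃ => G.str.tgt (φ₂.ar k₃))) G.str.anchor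

section SmoothStructure

variable {dO dA : ℕ}
  [ChartedSpace (EuclideanSpace ℝ (Fin dO)) (HPullOb φ₁ φ₂)]
  [ChartedSpace (EuclideanSpace ℝ (Fin dA)) (HPullAr φ₁ φ₂)]

theorem contMDiff_hpullSrc [IsManifold (𝓡 dO) ∞ (HPullOb φ₁ φ₂)]
    (hO : IsObjectPullback φ₁ φ₂ dO) (hA : IsArrowPullback φ₁ φ₂ dA) :
    ContMDiff (𝓡 dA) (𝓡 dO) ∞ (hpullSrc (φ₁ := φ₁) (φ₂ := φ₂)) :=
  hO.contMDiff ((G₁.contMDiff_src.comp hA.smooth_left.fst).prodMk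
    (G₂.contMDiff_src.comp hA.smooth_left.snd))
    (contMDiff_mul hA.smooth_right (φ₂.smooth_ar.comp hA.smooth_left.snd) fun k => k.2.2)

theorem contMDiff_hpullTgt [IsManifold (𝓡 dO) ∞ (HPullOb φ₁ φ₂)]
    (hO : IsObjectPullback φ₁ φ₂ dO) (hA : IsArrowPullback φ₁ φ₂ dA) :
    ContMDiff (𝓡 dA) (𝓡 dO) ∞ (hpullTgt (φ₁ := φ₁) (φ₂ := φ₂)) :=
  hO.contMDiff ((G₁.contMDiff_tgt.comp hA.smooth_left.fst).prodMk
    (G₂.contMDiff_tgt.comp hA.smooth_left.snd))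
    (contMDiff_mul (φ₁.smooth_ar.comp hA.smooth_left.fst) hA.smooth_right fun k => k.2.1)

variable [IsManifold (𝓡 dA) ∞ (HPullAr φ₁ φ₂)]

theorem contMDiff_hpullUnit (hO : IsObjectPullback φ₁ φ₂ dO) (hA : IsArrowPullback φ₁ φ₂ dA) :
    ContMDiff (𝓡 dO) (𝓡 dA) ∞ (hpullUnit (φ₁ := φ₁) (φ₂ := φ₂)) :=
  hA.contMDiff ((G₁.isLie.smooth_unit.comp hO.smooth_left.fst).prodMk
    (G₂.isLie.smooth_unit.comp hO.smooth_left.snd)) hO.smooth_right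

theorem contMDiff_hpullInv (hA : IsArrowPullback φ₁ φ₂ dA) :
    ContMDiff (𝓡 dA) (𝓡 dA) ∞ (hpullInv (φ₁ := φ₁) (φ₂ := φ₂)) :=
  hA.contMDiff ((G₁.isLie.smooth_inv.comp hA.smooth_left.fst).prodMk
    (G₂.isLie.smooth_inv.comp hA.smooth_left.snd))
    (contMDiff_mul (φ₁.smooth_ar.comp hA.smooth_left.fst)
      (contMDiff_mul hA.smooth_right (φ₂.smooth_ar.comp hA.smooth_left.snd) fun k => k.2.2)
      hpull_inv_aux)

open Classical in
theorem exists_contMDiffOn_hpullMul (hA : IsArrowPullback φ₁ φ₂ dA) :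
    ∃ F : HPullAr φ₁ φ₂ × HPullAr φ₁ φ₂ → HPullAr φ₁ φ₂,
      ContMDiffOn ((𝓡 dA).prod (𝓡 dA)) (𝓡 dA) ∞ F {p | hpullSrc p.1 = hpullTgt p.2} ∧
        ∀ l k w, F (l, k) = hpullMul l k w := by
  obtain ⟨F, hF⟩ : ∃ F : HPullAr φ₁ φ₂ × HPullAr φ₁ φ₂ → HPullAr φ₁ φ₂,
      ∀ l k w, F (l, k) = hpullMul l k w :=
    ⟨fun p => if w : hpullSrc p.1 = hpullTgt p.2 then hpullMul p.1 p.2 w else p.1,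
      fun l k w => dif_pos w⟩
  have h₁ := hA.smooth_left.fst
  have h₃ := hA.smooth_left.snd
  refine ⟨F, hA.contMDiffOn (ContMDiffOn.prodMk ?_ ?_) ?_, hF⟩
  · exact contMDiffOn_of_eq_mul (h₁.comp contMDiff_fst).contMDiffOn
      (h₁.comp contMDiff_snd).contMDiffOn (fun p w => hpull_comp₁ w)
      fun p w => by rw [hF p.1 p.2 w]; rfl
  · exact contMDiffOn_of_eq_mul (h₃.comp contMDiff_fst).contMDiffOn
      (h₃.comp contMDiff_snd).contMDiffOn (fun p w => hpull_comp₃ w)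
      fun p w => by rw [hF p.1 p.2 w]; rfl
  · exact contMDiffOn_of_eq_mul (hA.smooth_right.comp contMDiff_snd).contMDiffOn
      (G.isLie.smooth_inv.comp (φ₂.smooth_ar.comp (h₃.comp contMDiff_fst))).contMDiffOn
      (fun p w => hpull_mid w) fun p w => by rw [hF p.1 p.2 w]; rfl

section

variable {E : Type*} [NormedAddCommGroup E] [NormedSpace ℝ E] {H : Type*} [TopologicalSpace H]
  {J : ModelWithCorners ℝ E H} {Z : Type*} [TopologicalSpace Z] [ChartedSpace H Z]

theorem contMDiff_hpullArOfSrc (hO : IsObjectPullback φ₁ φ₂ dO) (hA : IsArrowPullback φ₁ φ₂ dA)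
    {k₁ : Z → G₁.Ar} {k₃ : Z → G₂.Ar} {a : Z → HPullOb φ₁ φ₂} (hk₁ : ContMDiff J (𝓡 G₁.dimAr) ∞ k₁)
    (hk₃ : ContMDiff J (𝓡 G₂.dimAr) ∞ k₃) (ha : ContMDiff J (𝓡 dO) ∞ a)
    (h₁ : ∀ z, G₁.str.src (k₁ z) = (a z).1.1) (h₃ : ∀ z, G₂.str.src (k₃ z) = (a z).1.2.2) :
    ContMDiff J (𝓡 dA) ∞ fun z => hpullArOfSrc (k₁ z) (k₃ z) (a z) (h₁ z) (h₃ z) :=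
  hA.contMDiff (hk₁.prodMk hk₃) (contMDiff_mul (hO.smooth_right.comp ha)
    (G.isLie.smooth_inv.comp (φ₂.smooth_ar.comp hk₃)) fun z => src_eq_tgt_inv_of_src_eq (h₃ z))

theorem Hom.IsFullyFaithful.exists_contMDiff_hpullAr (h : φ₁.IsFullyFaithful)
    (hO : IsObjectPullback φ₁ φ₂ dO) (hA : IsArrowPullback φ₁ φ₂ dA)
    {k₃ : Z → G₂.Ar} {a b : Z → HPullOb φ₁ φ₂} (hk₃ : ContMDiff J (𝓡 G₂.dimAr) ∞ k₃)
    (ha : ContMDiff J (𝓡 dO) ∞ a) (hb : ContMDiff J (𝓡 dO) ∞ b)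
    (hs : ∀ z, G₂.str.src (k₃ z) = (a z).1.2.2) (ht : ∀ z, G₂.str.tgt (k₃ z) = (b z).1.2.2) :
    ∃ k : Z → HPullAr φ₁ φ₂, ContMDiff J (𝓡 dA) ∞ k ∧
      ∀ z, hpullSrc (k z) = a z ∧ hpullTgt (k z) = b z ∧ (k z).1.2.2 = k₃ z := by
  let k₂ : Z → G.Ar := fun z => G.str.mul (a z).1.2.1 (G.str.inv (φ₂.ar (k₃ z)))
    (src_eq_tgt_inv_of_src_eq (hs z))
  have hk₂ : ContMDiff J (𝓡 G.dimAr) ∞ k₂ := contMDiff_mul (hO.smooth_right.comp ha)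
    (G.isLie.smooth_inv.comp (φ₂.smooth_ar.comp hk₃)) _
  have hk₂_src : ∀ z, G.str.src (k₂ z) = G.str.tgt (φ₂.ar (k₃ z)) := fun z =>
    (G.str.src_mul _ _ _).trans (G.str.src_inv _)
  have hk₂_tgt : ∀ z, G.str.tgt (k₂ z) = φ₁.ob (a z).1.1 := fun z =>
    (G.str.tgt_mul _ _ _).trans (a z).2.1
  have hw : ∀ z, G.str.src (b z).1.2.1 = G.str.tgt (G.str.inv (k₂ z)) := fun z =>
    src_eq_tgt_inv_of_tgt_eq (hk₂_src z) (ht z)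
  choose k₁ hk₁_ar hk₁_anchor using fun z =>
    h.exists_of_eq (x := G.str.mul (b z).1.2.1 (G.str.inv (k₂ z)) (hw z))
      (y := ((b z).1.1, (a z).1.1)) (Prod.ext ((G.str.tgt_mul _ _ _).trans (b z).2.1)
        ((G.str.src_mul _ _ _).trans ((G.str.src_inv _).trans (hk₂_tgt z))))
  have hk₁ : ContMDiff J (𝓡 G₁.dimAr) ∞ k₁ := h.contMDiff
    ((contMDiff_mul (hO.smooth_right.comp hb) (G.isLie.smooth_inv.comp hk₂) hw).congr hk₁_ar)
    (((hO.smooth_left.fst.comp hb).prodMk (hO.smooth_left.fst.comp ha)).congr hk₁_anchor)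
  have hk₁_tgt : ∀ z, G₁.str.tgt (k₁ z) = (b z).1.1 := fun z => congrArg Prod.fst (hk₁_anchor z)
  have hk₁_src : ∀ z, G₁.str.src (k₁ z) = (a z).1.1 := fun z => congrArg Prod.snd (hk₁_anchor z)
  refine ⟨_, contMDiff_hpullArOfSrc hO hA hk₁ hk₃ ha hk₁_src hs, fun z =>
    ⟨hpullSrc_hpullArOfSrc (hk₁_src z) (hs z), hpullOb_ext (hk₁_tgt z)
      ((G.str.mul_congr (hk₁_ar z) rfl _).trans
        (G.str.inv_mul_cancel_right _ _ ((hw z).trans (G.str.tgt_inv _)))) (ht z), rfl⟩⟩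

end

variable [IsManifold (𝓡 dO) ∞ (HPullOb φ₁ φ₂)]

theorem surjective_modelDeriv_hpullSrc (hO : IsObjectPullback φ₁ φ₂ dO)
    (hA : IsArrowPullback φ₁ φ₂ dA) (k : HPullAr φ₁ φ₂) :
    Function.Surjective (modelDeriv (𝓡 dA) (𝓡 dO) hpullSrc k) := by
  have hsrc : ∀ l : G₁.Ar × G₂.Ar, Function.Surjective (modelDeriv _ _
      (Prod.map G₁.str.src G₂.str.src) l) := fun l =>
    surjective_modelDeriv_prodMap (G₁.mdifferentiable_src _) (G₂.mdifferentiable_src _)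
      (G₁.surjective_modelDeriv_src _) (G₂.surjective_modelDeriv_src _)
  obtain ⟨n, _, _, hW⟩ :=
    (IsTransversal.of_surjective_left hsrc).exists_isGoodPullback_subtype
      (G₁.contMDiff_src.prodMap G₂.contMDiff_src) hO.smooth_left
  have hθ := contMDiff_hpullArOfSrc hO hA hW.smooth_left.fst hW.smooth_left.snd hW.smooth_right
    (fun w => congrArg Prod.fst (hW.comm w)) (fun w => congrArg Prod.snd (hW.comm w))
  have hsurj := surjective_modelDeriv_of_comp
    (x := ⟨((k.1.1, k.1.2.2), hpullSrc k), rfl⟩)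
    ((contMDiff_hpullSrc hO hA _).mdifferentiableAt (by simp)) ((hθ _).mdifferentiableAt (by simp))
    (by simpa only [hpullSrc_hpullArOfSrc] using hW.surjective_modelDeriv_right (hsrc _))
  rwa [hpullArOfSrc_hpullSrc] at hsurj

theorem surjective_modelDeriv_hpullTgt (hO : IsObjectPullback φ₁ φ₂ dO)
    (hA : IsArrowPullback φ₁ φ₂ dA) (k : HPullAr φ₁ φ₂) :
    Function.Surjective (modelDeriv (𝓡 dA) (𝓡 dO) hpullTgt k) := by
  have hsurj := surjective_modelDeriv_of_comp (x := hpullInv k)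
    ((contMDiff_hpullTgt hO hA _).mdifferentiableAt (by simp))
    ((contMDiff_hpullInv hA _).mdifferentiableAt (by simp))
    (by simpa only [hpull_tgt_inv] using surjective_modelDeriv_hpullSrc hO hA (hpullInv k))
  rwa [show hpullInv (hpullInv k) = k from hpullStr.inv_inv k] at hsurj

theorem isLie_hpullStr (hO : IsObjectPullback φ₁ φ₂ dO) (hA : IsArrowPullback φ₁ φ₂ dA) :
    (hpullStr (φ₁ := φ₁) (φ₂ := φ₂)).IsLie dO dA where
  src_submersion := isSubmersion_of_surjective_modelDeriv (contMDiff_hpullSrc hO hA)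
    (surjective_modelDeriv_hpullSrc hO hA)
  tgt_submersion := isSubmersion_of_surjective_modelDeriv (contMDiff_hpullTgt hO hA)
    (surjective_modelDeriv_hpullTgt hO hA)
  smooth_mul := exists_contMDiffOn_hpullMul hA
  smooth_unit := contMDiff_hpullUnit hO hA
  smooth_inv := contMDiff_hpullInv hA

end SmoothStructure

namespace Hom.IsEssentiallySurjective

theorem nonempty_homotopyPullback (h : φ₁.IsEssentiallySurjective) (φ₂ : Hom G₂ G) :
    Nonempty (HomotopyPullback φ₁ φ₂) := by
  obtain ⟨dO, cO, mO, hO⟩ := (h.isTransversal φ₂).exists_isGoodPullback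
    (φ₁.smooth_ob.prodMap φ₂.smooth_ob) G.contMDiff_anchor isEmbedding_hpullOb range_hpullOb
  obtain ⟨dA, cA, mA, hA⟩ := (h.isTransversal_arrows φ₂).exists_isGoodPullback
    ((G.contMDiff_src.comp φ₁.smooth_ar).prodMap (G.contMDiff_tgt.comp φ₂.smooth_ar))
    G.contMDiff_anchor isEmbedding_hpullAr range_hpullAr
  exact ⟨⟨dO, dA, hO, hA, isLie_hpullStr hO hA⟩⟩

theorem surjective_hpullOb (h : φ₁.IsEssentiallySurjective) (φ₂ : Hom G₂ G) :
    Function.Surjective fun p : HPullOb φ₁ φ₂ => p.1.2.2 := by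
  intro x₂
  obtain ⟨-, -, -, -, hs, -⟩ := h
  obtain ⟨⟨⟨g, x₁⟩, e⟩, hg⟩ := hs (φ₂.ob x₂)
  exact ⟨⟨(x₁, G.str.inv g, x₂), (G.str.tgt_inv g).trans e, (G.str.src_inv g).trans hg⟩, rfl⟩

theorem surjective_modelDeriv_hpullOb {d : ℕ}
    [ChartedSpace (EuclideanSpace ℝ (Fin d)) (HPullOb φ₁ φ₂)] (h : φ₁.IsEssentiallySurjective)
    (hO : IsObjectPullback φ₁ φ₂ d) (p : HPullOb φ₁ φ₂) :
    Function.Surjective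
      (modelDeriv (𝓡 d) (𝓡 G₂.dimOb) (fun p : HPullOb φ₁ φ₂ => p.1.2.2) p) := by
  intro v₂
  obtain ⟨w, v₁, hwt, hws⟩ := h.exists_modelDeriv_tgt_eq_and_src_eq p.2.1
    (modelDeriv (𝓡 G₂.dimOb) (𝓡 G.dimOb) φ₂.ob p.1.2.2 v₂)
  obtain ⟨t, ⟨ht, -⟩, -⟩ := hO.existsUnique_modelDeriv p (v := (v₁, v₂)) (w := w) (by
    rw [modelDeriv_prodMap ((φ₁.smooth_ob _).mdifferentiableAt (by simp))
      ((φ₂.smooth_ob _).mdifferentiableAt (by simp)), modelDeriv_anchor, hwt, hws])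
  refine ⟨t, ?_⟩
  rw [modelDeriv_prodMk ((hO.smooth_left.fst p).mdifferentiableAt (by simp))
    ((hO.smooth_left.snd p).mdifferentiableAt (by simp))] at ht
  exact congrArg Prod.snd ht

end Hom.IsEssentiallySurjective

namespace HomotopyPullback

variable (P : HomotopyPullback φ₁ φ₂)

theorem isSurjective_baseChange (h : φ₁.IsEssentiallySurjective) : P.baseChange.IsSurjective :=
  let _ := P.chartedOb
  have _ := P.mfdOb
  ⟨h.surjective_hpullOb φ₂, isSubmersion_of_surjective_modelDeriv P.pullbackOb.smooth_left.snd
    (h.surjective_modelDeriv_hpullOb P.pullbackOb)⟩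

theorem isFullyFaithful_baseChange (h : φ₁.IsWeakEquivalence) : P.baseChange.IsFullyFaithful := by
  let _ := P.chartedOb
  let _ := P.chartedAr
  have _ := P.mfdOb
  have _ := P.mfdAr
  have hob : ContMDiff (𝓡 P.dimOb) (𝓡 G₂.dimOb) ∞ (fun p : HPullOb φ₁ φ₂ => p.1.2.2) :=
    P.pullbackOb.smooth_left.snd
  have hob_surj := h.2.surjective_modelDeriv_hpullOb P.pullbackOb
  have hob_diff := hob.mdifferentiable (by simp)
  have htrans : IsTransversal (𝓡 G₂.dimAr) ((𝓡 P.dimOb).prod (𝓡 P.dimOb))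
      ((𝓡 G₂.dimOb).prod (𝓡 G₂.dimOb)) G₂.str.anchor
      (Prod.map (fun p : HPullOb φ₁ φ₂ => p.1.2.2) (fun p : HPullOb φ₁ φ₂ => p.1.2.2)) :=
    .of_surjective_right fun _ => surjective_modelDeriv_prodMap (hob_diff _) (hob_diff _)
      (hob_surj _) (hob_surj _)
  obtain ⟨n, _, _, hW⟩ :=
    htrans.exists_isGoodPullback_subtype G₂.contMDiff_anchor (hob.prodMap hob)
  obtain ⟨θ, hθ, hθ_eq⟩ := h.1.exists_contMDiff_hpullAr P.pullbackOb P.pullbackAr hW.smooth_left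
    hW.smooth_right.snd hW.smooth_right.fst (fun w => congrArg Prod.snd (hW.comm w))
    (fun w => congrArg Prod.fst (hW.comm w))
  refine hW.of_inverse P.pullbackAr.smooth_left.snd
    ((contMDiff_hpullTgt P.pullbackOb P.pullbackAr).prodMk
      (contMDiff_hpullSrc P.pullbackOb P.pullbackAr)) (fun _ => rfl) (fun k l hkl => ?_) hθ
    (fun w => (hθ_eq w).2.2) (fun w => Prod.ext (hθ_eq w).2.1 (hθ_eq w).1)
  exact h.1.hpullAr_ext (congrArg (fun w => w.2.2) hkl) (congrArg (fun w => w.2.1) hkl)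
    (congrArg Prod.fst hkl)

end HomotopyPullback

end HomotopyPullback

end LieGroupoid

/-- If `φ₁` is a weak equivalence, then the homotopy pullback of `φ₁` and `φ₂` exists and the
base-change of `φ₁` is a surjective equivalence. -/
theorem mainTheorem10 {G G₁ G₂ : LieGroupoid.{u}} (φ₁ : LieGroupoid.Hom G₁ G)
    (φ₂ : LieGroupoid.Hom G₂ G) (hφ₁ : φ₁.IsWeakEquivalence) :
    Nonempty (LieGroupoid.HomotopyPullback φ₁ φ₂) ∧
      ∀ P : LieGroupoid.HomotopyPullback φ₁ φ₂, P.baseChange.IsSurjectiveEquivalence :=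
  ⟨hφ₁.2.nonempty_homotopyPullback φ₂, fun P =>
    ⟨P.isSurjective_baseChange hφ₁.2, P.isFullyFaithful_baseChange hφ₁⟩⟩
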